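/- All manifolds, tensor fields and diffeomorphisms are smooth. Conventions: $d\alpha(X,Y)=X(\alpha(Y))-Y(\alpha(X))-\alpha([X,Y])$ for a 1-form $\alpha$ (and the analogous unnormalized formula for 2-forms), $\alpha\wedge\beta=\alpha\otimes\beta-\beta\otimes\alpha$ for 1-forms, $(\mathcal L_UA)X=[U,AX]-A[U,X]$, and $N_A(X,Y)=A^2[X,Y]-A([AX,Y]+[X,AY])+[AX,AY]$ for a $(1,1)$-tensor field $A$. A *quasi-Vaisman manifold* $(M,J,g,\theta)$ is a Hermitian manifold $(M,J,g)$ (that is, $g$ is a Riemannian metric, $J^2=-\mathrm{Id}$, $g(J\cdot,J\cdot)=g$, $N_J=0$) with a closed 1-form $\theta$ whose metric dual $U$ has unit length, is Killing ($\mathcal L_Ug=0$) and satisfies $\mathcal L_UJ=0$, and such that $d\Omega=d\eta\wedge\theta$, where $\Omega(X,Y)=g(X,JY)$ and $\eta=-\theta\circ J$. Let $V$ be the metric dual of $\eta$. An *almost contact metric structure* $(\varphi,\xi,\eta,h)$ on a manifold consists of an endomorphism $\varphi$ of the tangent bundle, a vector field $\xi$, a 1-form $\eta$ and a Riemannian metric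 $h$ with $\varphi^2=-\mathrm{Id}+\eta\otimes\xi$, $\eta(\xi)=1$, $h(\varphi X,\varphi Y)=h(X,Y)-\eta(X)\eta(Y)$. It is *quasi-Sasakian* if $N_\varphi+d\eta\otimes\xi=0$ and $d\Phi=0$, where $\Phi(X,Y)=h(X,\varphi Y)$. **Proposition.** Let $(M,J,g,\theta)$ be a quasi-Vaisman manifold, with $U$, $V$ as above. On $M\times\mathbb R$ put $h=g+dt\otimes dt$, $\xi=V$, $\eta=h(\xi,\cdot)$, and let $\varphi$ be the $(1,1)$-tensor field with $$\varphi U=\tfrac{\partial}{\partial t},\qquad \varphi\tfrac{\partial}{\partial t}=-U,\qquad \varphi V=0,\qquad \varphi X=JX\ \text{ for } X\in TM,\ X\perp U,V .$$ Then $(\varphi,\xi,\eta,h)$ is a quasi-Sasakian structure on $M\times\mathbb R$. Moreover, let $f\colon M\to M$ be a diffeomorphism that preserves $g$, $J$ and $\theta$, let $a>0$, and let $M_{(f,a)}=(M\times\mathbb R)/\mathbb Z$ be the mapping torus, the quotient by the action $k\cdot(x,t)=(f^k(x),t+ak)$. Then $M_{(f,a)}$ with the quotient topology is a Hausdorff,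 second countable space that carries a smooth manifold structure for which the projection $M\times\mathbb R\to M_{(f,a)}$ is a local diffeomorphism, and it carries a quasi-Sasakian structure induced from $(\varphi,\xi,\eta,h)$ through this projection. -/

import Mathlib

open scoped Manifold ContDiff
open Bundle VectorField

noncomputable section

namespace QV

section Tensors

variable {E : Type*} [NormedAddCommGroup E] [NormedSpace ℝ E]
  {H : Type*} [TopologicalSpace H] (I : ModelWithCorners ℝ E H)
  {M : Type*} [TopologicalSpace M] [ChartedSpace H M]

/-- (Not necessarily continuous) vector fields on `M`. -/
abbrev VField (M : Type*) [TopologicalSpace M] [ChartedSpace H M] : Type _ :=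
  Π x : M, TangentSpace I x

/-- Pointwise linear `1`-forms on `M`; smoothness is `IsSmoothOneForm`. -/
abbrev OneForm (M : Type*) [TopologicalSpace M] [ChartedSpace H M] : Type _ :=
  Π x : M, TangentSpace I x →L[ℝ] ℝ

/-- Pointwise linear endomorphisms of `TM`; smoothness is `IsSmoothEndo`. -/
abbrev Endo (M : Type*) [TopologicalSpace M] [ChartedSpace H M] : Type _ :=
  Π x : M, TangentSpace I x →L[ℝ] TangentSpace I x

/-- Pointwise bilinear forms on `TM`. -/
abbrev BilinField (M : Type*) [TopologicalSpace M] [ChartedSpace H M] : Type _ :=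
  Π x : M, TangentSpace I x → TangentSpace I x → ℝ

variable {I}

/-- The endomorphism `A` applied to the vector field `X`. -/
def Endo.app (A : Endo I M) (X : VField I M) : VField I M := fun x => A x (X x)

/-- The function `X f`, the derivative of `f` along `X`. -/
def lieFun (X : VField I M) (f : M → ℝ) : M → ℝ := fun x => mvfderiv I f x (X x)

/-- `dα (X, Y) = X (α Y) - Y (α X) - α [X, Y]`. -/
def dOne (α : OneForm I M) (X Y : VField I M) : M → ℝ := fun x =>
  lieFun X (fun y => α y (Y y)) x - lieFun Y (fun y => α y (X y)) x
    - α x (mlieBracket I X Y x)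

/-- The exterior derivative of a `2`-form `σ`, evaluated on three vector fields. -/
def dTwo (σ : BilinField I M) (X Y Z : VField I M) : M → ℝ := fun x =>
  lieFun X (fun y => σ y (Y y) (Z y)) x - lieFun Y (fun y => σ y (X y) (Z y)) x
    + lieFun Z (fun y => σ y (X y) (Y y)) x
    - σ x (mlieBracket I X Y x) (Z x) + σ x (mlieBracket I X Z x) (Y x)
    - σ x (mlieBracket I Y Z x) (X x)

/-- `(dα ∧ β) (X, Y, Z)` for `1`-forms `α`, `β` (wedge product normalised so that
`a ∧ b = a ⊗ b - b ⊗ a` on `1`-forms). -/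
def dOneWedge (α β : OneForm I M) (X Y Z : VField I M) : M → ℝ := fun x =>
  dOne α X Y x * β x (Z x) + dOne α Y Z x * β x (X x) + dOne α Z X x * β x (Y x)

/-- The Nijenhuis torsion
`N_A (X, Y) = A² [X, Y] - A ([A X, Y] + [X, A Y]) + [A X, A Y]`. -/
def nijenhuis (A : Endo I M) (X Y : VField I M) : VField I M := fun x =>
  A x (A x (mlieBracket I X Y x))
    - A x (mlieBracket I (A.app X) Y x + mlieBracket I X (A.app Y) x)
    + mlieBracket I (A.app X) (A.app Y) x

/-- `(L_U g) (X, Y)`. -/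
def lieBilin (U : VField I M) (g : BilinField I M) (X Y : VField I M) : M → ℝ := fun x =>
  lieFun U (fun y => g y (X y) (Y y)) x - g x (mlieBracket I U X x) (Y x)
    - g x (X x) (mlieBracket I U Y x)

/-- `(L_U A) X = [U, A X] - A [U, X]`. -/
def lieEndo (U : VField I M) (A : Endo I M) (X : VField I M) : VField I M := fun x =>
  mlieBracket I U (A.app X) x - A x (mlieBracket I U X x)

variable [IsManifold I ∞ M]

/-- Smooth vector fields. -/
def IsSmoothField (X : VField I M) : Prop :=
  ContMDiff I I.tangent ∞ (fun x => (⟨x, X x⟩ : TangentBundle I M))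

/-- A `1`-form is smooth when it is smooth as a function on the total space `TM`. -/
def IsSmoothOneForm (α : OneForm I M) : Prop :=
  ContMDiff I.tangent 𝓘(ℝ, ℝ) ∞ (fun v : TangentBundle I M => α v.1 v.2)

/-- An endomorphism of `TM` is smooth when it is smooth as a map `TM → TM`. -/
def IsSmoothEndo (A : Endo I M) : Prop :=
  ContMDiff I.tangent I.tangent ∞
    (fun v : TangentBundle I M => (⟨v.1, A v.1 v.2⟩ : TangentBundle I M))

variable (I M) in
/-- Smooth Riemannian metrics on `M`. -/
abbrev Metric : Type _ := ContMDiffRiemannianMetric I ∞ E (fun x : M => TangentSpace I x)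

/-- The metric as a bilinear form field. -/
def Metric.form (g : Metric I M) : BilinField I M := fun x v w => g.inner x v w

/-- The fundamental `2`-form `(X, Y) ↦ g (X, A Y)`. -/
def fundForm (g : Metric I M) (A : Endo I M) : BilinField I M :=
  fun x v w => g.inner x v (A x w)

theorem exists_metricDual [FiniteDimensional ℝ E] (g : Metric I M) (α : OneForm I M) (x : M) :
    ∃ u : TangentSpace I x, ∀ v, g.inner x u v = α x v := by
  have : FiniteDimensional ℝ (TangentSpace I x) := inferInstanceAs (FiniteDimensional ℝ E)
  let L : TangentSpace I x →ₗ[ℝ] Module.Dual ℝ (TangentSpace I x) :=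
    { toFun := fun u => (g.inner x u : TangentSpace I x →ₗ[ℝ] ℝ)
      map_add' := fun u v => by ext; simp
      map_smul' := fun c u => by ext; simp }
  have hinj : Function.Injective L := by
    rw [injective_iff_map_eq_zero]
    intro u hu
    by_contra hne
    have h1 := g.pos x u hne
    have h2 : g.inner x u u = 0 := congrArg (fun l => l u) hu
    exact absurd h2 h1.ne'
  have hsurj : Function.Surjective L :=
    (LinearMap.injective_iff_surjective_of_finrank_eq_finrank
      Subspace.dual_finrank_eq.symm).1 hinj
  obtain ⟨u, hu⟩ := hsurj (α x : TangentSpace I x →ₗ[ℝ] ℝ)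
  exact ⟨u, fun v => congrArg (fun l => l v) hu⟩

/-- The metric dual of a `1`-form: the vector field `U` with `g (U, ·) = α`. -/
def metricDual [FiniteDimensional ℝ E] (g : Metric I M) (α : OneForm I M) : VField I M :=
  fun x => Classical.choose (exists_metricDual g α x)

theorem inner_metricDual [FiniteDimensional ℝ E] (g : Metric I M) (α : OneForm I M) (x : M)
    (v : TangentSpace I x) : g.inner x (metricDual g α x) v = α x v :=
  Classical.choose_spec (exists_metricDual g α x) v

/-- Hermitian structures: `J` is a smooth almost complex structure, orthogonal for `g`, with
vanishing Nijenhuis torsion. -/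
structure IsHermitian (J : Endo I M) (g : Metric I M) : Prop where
  smooth : IsSmoothEndo J
  sq : ∀ (x : M) (v : TangentSpace I x), J x (J x v) = -v
  orthogonal : ∀ (x : M) (v w : TangentSpace I x), g.inner x (J x v) (J x w) = g.inner x v w
  integrable : ∀ X Y : VField I M, IsSmoothField X → IsSmoothField Y →
    ∀ x, nijenhuis J X Y x = 0

/-- `η = -θ ∘ J`. -/
def antiLee (J : Endo I M) (θ : OneForm I M) : OneForm I M := fun x => -(θ x ∘L J x)

/-- Quasi-Vaisman structures `(J, g, θ)`. -/
structure IsQuasiVaisman [FiniteDimensional ℝ E] (J : Endo I M) (g : Metric I M)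
    (θ : OneForm I M) : Prop where
  hermitian : IsHermitian J g
  smooth : IsSmoothOneForm θ
  closed : ∀ X Y : VField I M, IsSmoothField X → IsSmoothField Y → ∀ x, dOne θ X Y x = 0
  unit : ∀ x, g.inner x (metricDual g θ x) (metricDual g θ x) = 1
  killing : ∀ X Y : VField I M, IsSmoothField X → IsSmoothField Y →
    ∀ x, lieBilin (metricDual g θ) g.form X Y x = 0
  holomorphic : ∀ X : VField I M, IsSmoothField X → ∀ x, lieEndo (metricDual g θ) J X x = 0
  d_fundForm : ∀ X Y Z : VField I M, IsSmoothField X → IsSmoothField Y → IsSmoothField Z →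
    ∀ x, dTwo (fundForm g J) X Y Z x = dOneWedge (antiLee J θ) θ X Y Z x

/-- Almost contact metric structures `(φ, ξ, η, h)`. -/
structure IsAlmostContactMetric (φ : Endo I M) (ξ : VField I M) (η : OneForm I M)
    (h : Metric I M) : Prop where
  smooth_φ : IsSmoothEndo φ
  smooth_ξ : IsSmoothField ξ
  smooth_η : IsSmoothOneForm η
  sq : ∀ (x : M) (v : TangentSpace I x), φ x (φ x v) = -v + η x v • ξ x
  reeb : ∀ x, η x (ξ x) = 1
  compat : ∀ (x : M) (v w : TangentSpace I x),
    h.inner x (φ x v) (φ x w) = h.inner x v w - η x v * η x w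

/-- Quasi-Sasakian structures: almost contact metric structures that are normal,
`N_φ + dη ⊗ ξ = 0`, and whose fundamental `2`-form is closed. -/
structure IsQuasiSasakian (φ : Endo I M) (ξ : VField I M) (η : OneForm I M)
    (h : Metric I M) : Prop extends IsAlmostContactMetric φ ξ η h where
  normal : ∀ X Y : VField I M, IsSmoothField X → IsSmoothField Y →
    ∀ x, nijenhuis φ X Y x + dOne η X Y x • ξ x = 0
  closed : ∀ X Y Z : VField I M, IsSmoothField X → IsSmoothField Y → IsSmoothField Z →
    ∀ x, dTwo (fundForm h φ) X Y Z x = 0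

/-- The structure `(φ', ξ', η', h')` on `N` is induced by `(φ, ξ, η, h)` on `M` through the map
`q : M → N`, i.e. `dq` intertwines the two structures. -/
structure IsInducedBy {N : Type*} [TopologicalSpace N] [ChartedSpace H N] [IsManifold I ∞ N]
    (q : M → N) (φ : Endo I M) (ξ : VField I M) (η : OneForm I M) (h : Metric I M)
    (φ' : Endo I N) (ξ' : VField I N) (η' : OneForm I N) (h' : Metric I N) : Prop where
  endo : ∀ (p : M) (v : TangentSpace I p),
    φ' (q p) (mfderiv I I q p v) = mfderiv I I q p (φ p v)
  field : ∀ p : M, ξ' (q p) = mfderiv I I q p (ξ p)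
  form : ∀ (p : M) (v : TangentSpace I p), η' (q p) (mfderiv I I q p v) = η p v
  metric : ∀ (p : M) (v w : TangentSpace I p),
    h'.inner (q p) (mfderiv I I q p v) (mfderiv I I q p w) = h.inner p v w

end Tensors

section Product

variable {E : Type*} [NormedAddCommGroup E] [NormedSpace ℝ E]
  {H : Type*} [TopologicalSpace H] {I : ModelWithCorners ℝ E H}
  {M : Type*} [TopologicalSpace M] [ChartedSpace H M]

/-- The differential of the projection `M × ℝ → M`. -/
def prM (p : M × ℝ) : TangentSpace (I.prod 𝓘(ℝ, ℝ)) p →L[ℝ] TangentSpace I p.1 :=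
  mfderiv (I.prod 𝓘(ℝ, ℝ)) I Prod.fst p

/-- The `1`-form `dt` on `M × ℝ`. -/
def dt : OneForm (I.prod 𝓘(ℝ, ℝ)) (M × ℝ) := fun p => mvfderiv (I.prod 𝓘(ℝ, ℝ)) Prod.snd p

/-- The inclusion of `T_x M` in `T_(x,t) (M × ℝ)`. -/
def inclM (p : M × ℝ) : TangentSpace I p.1 →L[ℝ] TangentSpace (I.prod 𝓘(ℝ, ℝ)) p :=
  mfderiv I (I.prod 𝓘(ℝ, ℝ)) (fun x : M => (x, p.2)) p.1

/-- The vector field `∂/∂t` on `M × ℝ`. -/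
def ddt : VField (I.prod 𝓘(ℝ, ℝ)) (M × ℝ) := fun p =>
  mfderiv 𝓘(ℝ, ℝ) (I.prod 𝓘(ℝ, ℝ)) (fun t : ℝ => (p.1, t)) p.2
    ((NormedSpace.fromTangentSpace p.2).symm 1)

/-- A vector field on `M`, regarded as a vector field on `M × ℝ`. -/
def liftField (X : VField I M) : VField (I.prod 𝓘(ℝ, ℝ)) (M × ℝ) := fun p => inclM p (X p.1)

/-- A `1`-form on `M`, pulled back to `M × ℝ`. -/
def liftForm (α : OneForm I M) : OneForm (I.prod 𝓘(ℝ, ℝ)) (M × ℝ) := fun p => α p.1 ∘L prM p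

/-- The `(1,1)`-tensor on `M × ℝ` that sends `U` to `∂/∂t`, `∂/∂t` to `-U`, `V` to `0` and agrees
with `J` on `⟨U, V⟩^⊥ ⊆ TM`: here `U`, `V` are the metric duals of `θ`, `η`, and
`w - θ(w) U - η(w) V` is the component of `w ∈ TM` orthogonal to `U` and `V` when these are
orthonormal. -/
def prodPhi (J : Endo I M) (θ η : OneForm I M) (U V : VField I M) :
    Endo (I.prod 𝓘(ℝ, ℝ)) (M × ℝ) := fun p =>
  inclM p ∘L J p.1 ∘L
      (ContinuousLinearMap.id ℝ (TangentSpace I p.1) - (θ p.1).smulRight (U p.1)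
        - (η p.1).smulRight (V p.1)) ∘L prM p
    + (liftForm θ p).smulRight (ddt p) - (dt p).smulRight (liftField U p)

end Product

section MappingTorus

/-- Orbit equivalence of the `ℤ`-action `k · (x, t) = (f^k x, t + a k)` on `M × ℝ`. -/
def mappingTorusSetoid {M : Type*} (f : Equiv.Perm M) (a : ℝ) : Setoid (M × ℝ) where
  r p q := ∃ k : ℤ, q = ((f ^ k) p.1, p.2 + a * k)
  iseqv :=
    { refl := fun p => ⟨0, by simp⟩
      symm := by
        rintro p q ⟨k, rfl⟩
        exact ⟨-k, by simp⟩
      trans := by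
        rintro p q r ⟨k, rfl⟩ ⟨l, rfl⟩
        refine ⟨l + k, ?_⟩
        simp only [zpow_add, Equiv.Perm.mul_apply, Int.cast_add, Prod.mk.injEq, true_and]
        ring }

/-- The mapping torus of `f` with parameter `a`, with the quotient topology. -/
def MappingTorus {M : Type*} (f : Equiv.Perm M) (a : ℝ) : Type _ :=
  Quotient (mappingTorusSetoid f a)

instance {M : Type*} [TopologicalSpace M] (f : Equiv.Perm M) (a : ℝ) :
    TopologicalSpace (MappingTorus f a) :=
  inferInstanceAs (TopologicalSpace (Quotient (mappingTorusSetoid f a)))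

/-- The quotient projection `M × ℝ → M_(f,a)`. -/
def MappingTorus.proj {M : Type*} (f : Equiv.Perm M) (a : ℝ) : M × ℝ → MappingTorus f a :=
  Quotient.mk (mappingTorusSetoid f a)

variable {E : Type*} [NormedAddCommGroup E] [NormedSpace ℝ E]
  {H : Type*} [TopologicalSpace H] {I : ModelWithCorners ℝ E H}
  {M : Type*} [TopologicalSpace M] [ChartedSpace H M] [IsManifold I ∞ M]

/-- The diffeomorphism `f` is an isometry of `g` and preserves `J` and `θ`. -/
structure Preserves (f : M ≃ₘ^∞⟮I, I⟯ M) (J : Endo I M) (g : Metric I M)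
    (θ : OneForm I M) : Prop where
  metric : ∀ (x : M) (v w : TangentSpace I x),
    g.inner (f x) (mfderiv I I f x v) (mfderiv I I f x w) = g.inner x v w
  complex : ∀ (x : M) (v : TangentSpace I x),
    mfderiv I I f x (J x v) = J (f x) (mfderiv I I f x v)
  form : ∀ (x : M) (v : TangentSpace I x), θ (f x) (mfderiv I I f x v) = θ x v

end MappingTorus

end QV

end

/-!
The tensorial identities on `M × ℝ` are checked on the fields `W + c ∂/∂t`, where `W` is a field on
`M` on which both `θ` and `η = -θ ∘ J` are constant (`IsAdapted`). Such fields take every value at a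
given point, and the torsion and exterior derivatives depend only on values (`nijenhuis_congr`,
`dOne_congr`, `IsTwoForm.dTwo_congr`). They are stable under `φ`, because with `a = θ W`, `b = η W`
one has `φ (W + c ∂/∂t) = (J W - a V + (b - c) U) + a ∂/∂t`, and their brackets are brackets on `M`
(`mlieBracket_liftAdd`).

On `M` the closedness of `θ` gives `θ [W, W'] = 0` for adapted `W`, `W'`; hence
`dη (W, W') = -η [W, W']`, and `N_J = 0` shows that `dη` is of type `(1,1)` and that `V = J U` is
holomorphic along with `U`. In `N_φ + dη ⊗ ξ` all brackets with `U` and `V` then cancel, and what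
remains is `N_J (W, W') = 0` (`IsQuasiVaisman.normal_vaisman`). The fundamental form of the product
is `Ω` up to terms that are constant on adapted fields, so that its differential is
`dΩ - dη ∧ θ = 0` (`IsQuasiVaisman.closed_vaisman`).

The projection to the mapping torus is an open map that is injective on open slabs of height
`a`, hence a local homeomorphism. Charts of the quotient are its local inverses followed by charts
of `M × ℝ`; transition maps are smooth because a local inverse after the projection is locally a
deck map (`HasSmoothDeck.contMDiffAt_localInverseAt_comp`). The orbit relation is a locally finite
union of graphs, hence closed, so the quotient is Hausdorff.

Finally the deck maps preserve `φ`, `ξ`, `η`, `h` (`IsAutomorphism.isInducedBy_prod`), so these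
tensors descend pointwise (`exists_isInducedBy`), and the quasi-Sasakian equations descend with them
because each of their terms is natural under local diffeomorphisms
(`IsInducedBy.isQuasiSasakian`).
-/

open scoped Manifold ContDiff

noncomputable section

namespace QV
open Topology Filter

/-! ### Smoothness criteria for tensor fields -/

section Criteria

variable {E : Type*} [NormedAddCommGroup E] [NormedSpace ℝ E]
  {H : Type*} [TopologicalSpace H] {I : ModelWithCorners ℝ E H}
  {M : Type*} [TopologicalSpace M] [ChartedSpace H M] {n : WithTop ℕ∞}

/-- Smoothness of an operator-valued map on a finite-dimensional space can be tested on vectors. -/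
theorem contMDiffAt_clm_of_apply {F G : Type*} [NormedAddCommGroup F] [NormedSpace ℝ F]
    [FiniteDimensional ℝ F] [NormedAddCommGroup G] [NormedSpace ℝ G]
    {f : M → F →L[ℝ] G} {x : M}
    (h : ∀ v, ContMDiffAt I 𝓘(ℝ, G) n (fun y => f y v) x) :
    ContMDiffAt I 𝓘(ℝ, F →L[ℝ] G) n f x := by
  let d := Module.finrank ℝ F
  have hd : d = Module.finrank ℝ (Fin d → ℝ) := (Module.finrank_fin_fun ℝ).symm
  let e₁ := ContinuousLinearEquiv.ofFinrankEq hd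
  let e₂ := (e₁.arrowCongr (1 : G ≃L[ℝ] G)).trans (ContinuousLinearEquiv.piRing (Fin d))
  have h2 : ContMDiffAt I 𝓘(ℝ, Fin d → G) n (e₂ ∘ f) x := by
    rw [contMDiffAt_pi_space]
    exact fun i => h _
  have h3 := (e₂.symm.contDiff.contMDiff (n := n)).contMDiffAt.comp x h2
  simpa [Function.comp_def] using! h3

variable {F₁ : Type*} [NormedAddCommGroup F₁] [NormedSpace ℝ F₁] [FiniteDimensional ℝ F₁]
  {E₁ : M → Type*} [TopologicalSpace (TotalSpace F₁ E₁)] [∀ x, AddCommGroup (E₁ x)]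
  [∀ x, Module ℝ (E₁ x)] [∀ x, TopologicalSpace (E₁ x)]
  [FiberBundle F₁ E₁] [VectorBundle ℝ F₁ E₁]
  {F₂ : Type*} [NormedAddCommGroup F₂] [NormedSpace ℝ F₂]
  {E₂ : M → Type*} [TopologicalSpace (TotalSpace F₂ E₂)] [∀ x, AddCommGroup (E₂ x)]
  [∀ x, Module ℝ (E₂ x)] [∀ x, TopologicalSpace (E₂ x)]
  [∀ x, IsTopologicalAddGroup (E₂ x)] [∀ x, ContinuousSMul ℝ (E₂ x)]
  [FiberBundle F₂ E₂] [VectorBundle ℝ F₂ E₂]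

/-- A section of a bundle of homomorphisms is smooth if it sends smooth local sections to smooth
local sections: in a trivialization, test on constant sections. -/
theorem contMDiffAt_hom_of_apply (A : Π x, E₁ x →L[ℝ] E₂ x) (x : M)
    (h : ∀ σ : Π y, E₁ y, ContMDiffAt I (I.prod 𝓘(ℝ, F₁)) n (fun y => TotalSpace.mk' F₁ y (σ y)) x →
      ContMDiffAt I (I.prod 𝓘(ℝ, F₂)) n (fun y => TotalSpace.mk' F₂ y (A y (σ y))) x) :
    ContMDiffAt I (I.prod 𝓘(ℝ, F₁ →L[ℝ] F₂)) n
      (fun y => TotalSpace.mk' (F₁ →L[ℝ] F₂) (E := fun y => E₁ y →L[ℝ] E₂ y) y (A y)) x := by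
  rw [contMDiffAt_hom_bundle]
  refine ⟨contMDiffAt_id, contMDiffAt_clm_of_apply fun v => ?_⟩
  obtain ⟨σ₀, hσ₀⟩ : ∃ σ₀ : E₁ x, (trivializationAt F₁ E₁ x ⟨x, σ₀⟩).2 = v :=
    ⟨(trivializationAt F₁ E₁ x).symm x v, by
      rw [Bundle.Trivialization.apply_mk_symm _ (FiberBundle.mem_baseSet_trivializationAt' x)]⟩
  have h1 := h _ (FiberBundle.contMDiffAt_extend (k := n) I F₁ σ₀)
  rw [contMDiffAt_section] at h1
  refine h1.congr_of_eventuallyEq ?_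
  filter_upwards [(trivializationAt F₁ E₁ x).open_baseSet.mem_nhds
      (FiberBundle.mem_baseSet_trivializationAt' x),
    (trivializationAt F₂ E₂ x).open_baseSet.mem_nhds
      (FiberBundle.mem_baseSet_trivializationAt' x)] with y hy hy'
  simp [ContinuousLinearMap.inCoordinates_eq hy hy', FiberBundle.extend, hσ₀]

end Criteria

section Tensors

variable {E : Type*} [NormedAddCommGroup E] [NormedSpace ℝ E]
  {H : Type*} [TopologicalSpace H] {I : ModelWithCorners ℝ E H}
  {M : Type*} [TopologicalSpace M] [ChartedSpace H M] [IsManifold I ∞ M]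
  {E' : Type*} [NormedAddCommGroup E'] [NormedSpace ℝ E']
  {H' : Type*} [TopologicalSpace H'] {I' : ModelWithCorners ℝ E' H'}
  {N : Type*} [TopologicalSpace N] [ChartedSpace H' N]

/-- Vector fields that are smooth at a point. -/
abbrev SmoothFieldAt (X : VField I M) (x : M) : Prop :=
  ContMDiffAt I I.tangent ∞ (fun y => (⟨y, X y⟩ : TangentBundle I M)) x

/-- Vector fields that are differentiable at a point. -/
abbrev DiffFieldAt (X : VField I M) (x : M) : Prop :=
  MDifferentiableAt I I.tangent (fun y => (⟨y, X y⟩ : TangentBundle I M)) x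

theorem SmoothFieldAt.diffFieldAt {X : VField I M} {x : M} (h : SmoothFieldAt X x) :
    DiffFieldAt X x := h.mdifferentiableAt (by simp)

theorem isSmoothEndo_of_app [FiniteDimensional ℝ E] (A : Endo I M)
    (h : ∀ x X, SmoothFieldAt X x → SmoothFieldAt (A.app X) x) : IsSmoothEndo A := by
  intro v
  have h1 := contMDiffAt_hom_of_apply (I := I) (n := ∞) (F₁ := E) (F₂ := E)
    (E₁ := fun x : M => TangentSpace I x) (E₂ := fun x : M => TangentSpace I x)
    A v.1 (fun σ hσ => h _ σ hσ)
  have h2 : ContMDiffAt I.tangent I ∞ (fun w : TangentBundle I M => w.1) v :=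
    (contMDiff_proj (TangentSpace I : M → Type _)).contMDiffAt
  have h3 := h1.comp v h2
  exact ContMDiffAt.clm_bundle_apply (F₁ := E) (F₂ := E) (b := fun w : TangentBundle I M => w.1)
    (v := fun w => w.2) h3 contMDiffAt_id

theorem isSmoothOneForm_of_app [FiniteDimensional ℝ E] (α : OneForm I M)
    (h : ∀ x X, SmoothFieldAt X x → ContMDiffAt I 𝓘(ℝ, ℝ) ∞ (fun y => α y (X y)) x) :
    IsSmoothOneForm α := by
  intro v
  have h1 := contMDiffAt_hom_of_apply (I := I) (n := ∞) (F₁ := E) (F₂ := ℝ)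
    (E₁ := fun x : M => TangentSpace I x) (E₂ := Bundle.Trivial M ℝ)
    α v.1 (fun σ hσ => by
      rw [contMDiffAt_section]; exact h _ σ hσ)
  have h2 : ContMDiffAt I.tangent I ∞ (fun w : TangentBundle I M => w.1) v :=
    (contMDiff_proj (TangentSpace I : M → Type _)).contMDiffAt
  have h3 := h1.comp v h2
  have h4 := ContMDiffAt.clm_bundle_apply (F₁ := E) (F₂ := ℝ) (E₂ := Bundle.Trivial M ℝ)
    (E₁ := fun x : M => TangentSpace I x) (IB := I) (b := fun w : TangentBundle I M => w.1)
    (v := fun w => w.2) h3 contMDiffAt_id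
  rw [contMDiffAt_totalSpace] at h4
  exact h4.2

theorem contMDiff_bilin_of_apply [FiniteDimensional ℝ E]
    (B : Π x : M, TangentSpace I x →L[ℝ] TangentSpace I x →L[ℝ] ℝ)
    (h : ∀ x (X Y : VField I M), SmoothFieldAt X x → SmoothFieldAt Y x →
      ContMDiffAt I 𝓘(ℝ, ℝ) ∞ (fun y => B y (X y) (Y y)) x) :
    ContMDiff I (I.prod 𝓘(ℝ, E →L[ℝ] E →L[ℝ] ℝ)) ∞
      (fun b ↦ TotalSpace.mk' (E →L[ℝ] E →L[ℝ] ℝ)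
        (E := fun x : M => TangentSpace I x →L[ℝ] TangentSpace I x →L[ℝ] ℝ) b (B b)) := by
  intro x
  refine contMDiffAt_hom_of_apply (I := I) (n := ∞) (F₁ := E) (F₂ := E →L[ℝ] ℝ)
    (E₁ := fun x : M => TangentSpace I x)
    (E₂ := fun x : M => TangentSpace I x →L[ℝ] Bundle.Trivial M ℝ x) B x fun X hX => ?_
  refine contMDiffAt_hom_of_apply (I := I) (n := ∞) (F₁ := E) (F₂ := ℝ)
    (E₁ := fun x : M => TangentSpace I x) (E₂ := Bundle.Trivial M ℝ) _ x fun Y hY => ?_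
  rw [contMDiffAt_section]
  exact h x X Y hX hY

theorem Metric.contMDiffAt_inner (g : Metric I M) {b : N → M} {v w : Π p, TangentSpace I (b p)}
    {p : N} (hv : ContMDiffAt I' I.tangent ∞ (fun p => (⟨b p, v p⟩ : TangentBundle I M)) p)
    (hw : ContMDiffAt I' I.tangent ∞ (fun p => (⟨b p, w p⟩ : TangentBundle I M)) p) :
    ContMDiffAt I' 𝓘(ℝ, ℝ) ∞ (fun p => g.inner (b p) (v p) (w p)) p := by
  have hb : ContMDiffAt I' I ∞ b p := by
    simp only [contMDiffAt_totalSpace] at hv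
    exact hv.1
  have : ContMDiffAt I' (I.prod 𝓘(ℝ)) ∞
      (fun m ↦ TotalSpace.mk' ℝ (E := Bundle.Trivial M ℝ) (b m) (g.inner (b m) (v m) (w m))) p :=
    ContMDiffAt.clm_bundle_apply₂ (F₁ := E) (F₂ := E) (E₁ := fun x : M => TangentSpace I x)
      (E₂ := fun x : M => TangentSpace I x) ((g.contMDiff (b p)).comp p hb) hv hw
  simp only [contMDiffAt_totalSpace] at this
  exact this.2

theorem Metric.mdifferentiableAt_inner (g : Metric I M) {b : N → M}
    {v w : Π p, TangentSpace I (b p)}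
    {p : N} (hv : MDifferentiableAt I' I.tangent (fun p => (⟨b p, v p⟩ : TangentBundle I M)) p)
    (hw : MDifferentiableAt I' I.tangent (fun p => (⟨b p, w p⟩ : TangentBundle I M)) p) :
    MDifferentiableAt I' 𝓘(ℝ, ℝ) (fun p => g.inner (b p) (v p) (w p)) p := by
  have hb : MDifferentiableAt I' I b p := by
    simp only [mdifferentiableAt_totalSpace] at hv
    exact hv.1
  have : MDifferentiableAt I' (I.prod 𝓘(ℝ))
      (fun m ↦ TotalSpace.mk' ℝ (E := Bundle.Trivial M ℝ) (b m) (g.inner (b m) (v m) (w m))) p :=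
    MDifferentiableAt.clm_bundle_apply₂ (F₁ := E) (F₂ := E) (E₁ := fun x : M => TangentSpace I x)
      (E₂ := fun x : M => TangentSpace I x)
      (((g.contMDiff (b p)).mdifferentiableAt (by simp)).comp p hb) hv hw
  simp only [mdifferentiableAt_totalSpace] at this
  exact this.2

/-- In a trivialization the metric dual is obtained by inverting the Gram operator of the metric,
and inversion of operators is smooth. -/
theorem isSmoothField_metricDual [FiniteDimensional ℝ E] (g : Metric I M) {α : OneForm I M}
    (hα : IsSmoothOneForm α) : IsSmoothField (metricDual g α) := by
  intro x
  have hG := (contMDiffAt_hom_bundle _).1 (g.contMDiff x)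
  have ha := contMDiffAt_hom_of_apply (I := I) (n := ∞) (F₁ := E) (F₂ := ℝ)
    (E₁ := fun x : M => TangentSpace I x) (E₂ := Bundle.Trivial M ℝ)
    α x (fun σ hσ => by
      rw [contMDiffAt_section]; exact (hα.contMDiffAt).comp x hσ)
  rw [contMDiffAt_hom_bundle] at ha
  set e := trivializationAt E (fun x : M => TangentSpace I x) x with he
  let G : M → E →L[ℝ] E →L[ℝ] ℝ := fun y =>
    ContinuousLinearMap.inCoordinates E (fun x : M => TangentSpace I x) (E →L[ℝ] ℝ)
      (fun x : M => TangentSpace I x →L[ℝ] Bundle.Trivial M ℝ x) x y x y (g.inner y)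
  let a : M → E →L[ℝ] ℝ := fun y =>
    ContinuousLinearMap.inCoordinates E (fun x : M => TangentSpace I x) ℝ
      (Bundle.Trivial M ℝ) x y x y (α y)
  have hx : x ∈ e.baseSet := FiberBundle.mem_baseSet_trivializationAt' x
  have hGy : ∀ y ∈ e.baseSet, ∀ v w, G y v w = g.inner y (e.symm y v) (e.symm y w) := by
    intro y hy v w
    refine (inCoordinates_apply_eq₂ (F₃ := ℝ) (E₃ := Bundle.Trivial M ℝ) hy hy (by simp)).trans ?_
    simp [he]
  have hay : ∀ y ∈ e.baseSet, ∀ w, a y w = α y (e.symm y w) := by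
    intro y hy w
    simp only [a]
    rw [ContinuousLinearMap.inCoordinates_eq hy (by simp)]
    simp [he]
  have hbij : ∀ y ∈ e.baseSet, ∃ L : E ≃L[ℝ] (E →L[ℝ] ℝ), (L : E →L[ℝ] E →L[ℝ] ℝ) = G y := by
    intro y hy
    have hinj : Function.Injective (G y).toLinearMap := by
      rw [injective_iff_map_eq_zero]
      intro v hv
      by_contra hne
      have h1 : e.symm y v ≠ 0 := by
        intro h0
        apply hne
        have := (e.continuousLinearEquivAt ℝ y hy).symm.map_eq_zero_iff.1 h0
        exact this
      have h2 := g.pos y _ h1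
      have h3 : G y v v = 0 := by
        have : G y v = 0 := hv
        rw [this]; rfl
      rw [hGy y hy] at h3
      exact h2.ne' h3
    have hfr : Module.finrank ℝ E = Module.finrank ℝ (E →L[ℝ] ℝ) := by
      rw [← LinearMap.toContinuousLinearMap.finrank_eq]
      exact Subspace.dual_finrank_eq.symm
    exact ⟨(LinearEquiv.ofInjectiveOfFinrankEq (G y).toLinearMap hinj hfr).toContinuousLinearEquiv,
      by ext; rfl⟩
  obtain ⟨L, hL⟩ := hbij x hx
  have hinv : ContMDiffAt I 𝓘(ℝ, (E →L[ℝ] ℝ) →L[ℝ] E) ∞ (fun y => (G y).inverse) x := by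
    have h1 : ContDiffAt ℝ ∞ ContinuousLinearMap.inverse (G x) := hL ▸ contDiffAt_map_inverse L
    exact h1.contMDiffAt.comp x hG.2
  rw [contMDiffAt_section]
  refine (hinv.clm_apply ha.2).congr_of_eventuallyEq ?_
  filter_upwards [e.open_baseSet.mem_nhds hx] with y hy
  obtain ⟨L', hL'⟩ := hbij y hy
  have hu : e.symm y (e ⟨y, metricDual g α y⟩).2 = metricDual g α y := e.symm_apply_apply_mk hy _
  have key : G y (e ⟨y, metricDual g α y⟩).2 = a y := by
    ext w
    rw [hGy y hy, hay y hy, hu, inner_metricDual]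
  change _ = (G y).inverse (a y)
  rw [← key, ← hL', ContinuousLinearMap.inverse_equiv]
  simp [he]

end Tensors

/-! ### Tensoriality of the torsion and of exterior derivatives -/

section Tensoriality

variable {E : Type*} [NormedAddCommGroup E] [NormedSpace ℝ E]
  {H : Type*} [TopologicalSpace H] {I : ModelWithCorners ℝ E H}
  {M : Type*} [TopologicalSpace M] [ChartedSpace H M]

theorem Endo.app_add (A : Endo I M) (X Y : VField I M) : A.app (X + Y) = A.app X + A.app Y :=
  funext fun _ => map_add _ _ _

theorem Endo.app_smul (A : Endo I M) (f : M → ℝ) (X : VField I M) :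
    A.app (f • X) = f • A.app X :=
  funext fun _ => map_smul _ _ _

theorem nijenhuis_swap (A : Endo I M) (X Y : VField I M) (x : M) :
    nijenhuis A X Y x = -nijenhuis A Y X x := by
  simp only [nijenhuis]
  rw [mlieBracket_swap_apply (V := X) (W := Y), mlieBracket_swap_apply (V := A.app X) (W := Y),
    mlieBracket_swap_apply (V := X) (W := A.app Y),
    mlieBracket_swap_apply (V := A.app X) (W := A.app Y)]
  simp only [map_neg, map_add]
  abel

theorem dOne_swap (α : OneForm I M) (X Y : VField I M) (x : M) :
    dOne α X Y x = -dOne α Y X x := by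
  simp only [dOne]
  rw [mlieBracket_swap_apply (V := X) (W := Y)]
  simp only [map_neg]
  ring

theorem lieFun_mul (X : VField I M) {f h : M → ℝ} {x : M} (hf : MDifferentiableAt I 𝓘(ℝ, ℝ) f x)
    (hh : MDifferentiableAt I 𝓘(ℝ, ℝ) h x) :
    lieFun X (fun y => f y * h y) x = f x * lieFun X h x + lieFun X f x * h x := by
  have := mvfderiv_mul hf hh
  simp only [lieFun]
  rw [show (fun y => f y * h y) = f * h from rfl, this]
  simp [mul_comm]

theorem lieFun_add (X : VField I M) {f h : M → ℝ} {x : M} (hf : MDifferentiableAt I 𝓘(ℝ, ℝ) f x)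
    (hh : MDifferentiableAt I 𝓘(ℝ, ℝ) h x) :
    lieFun X (fun y => f y + h y) x = lieFun X f x + lieFun X h x := by
  have := mvfderiv_add hf hh
  simp only [lieFun]
  rw [show (fun y => f y + h y) = f + h from rfl, this]
  simp

theorem lieFun_neg (X : VField I M) {f : M → ℝ} {x : M} :
    lieFun X (fun y => -f y) x = -lieFun X f x := by
  simp only [lieFun]
  rw [show (fun y => -f y) = -f from rfl, mvfderiv_neg]
  simp

theorem lieFun_const (X : VField I M) (c : ℝ) (x : M) : lieFun X (fun _ => c) x = 0 := by
  simp only [lieFun]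
  rw [mvfderiv_const]
  simp

variable [IsManifold I ∞ M]

theorem IsSmoothEndo.diffFieldAt {A : Endo I M} (hA : IsSmoothEndo A) {X : VField I M} {x : M}
    (hX : DiffFieldAt X x) : DiffFieldAt (A.app X) x :=
  ((hA ⟨x, X x⟩).mdifferentiableAt (by simp)).comp x hX

theorem IsSmoothEndo.smoothFieldAt {A : Endo I M} (hA : IsSmoothEndo A) {X : VField I M} {x : M}
    (hX : SmoothFieldAt X x) : SmoothFieldAt (A.app X) x :=
  (hA ⟨x, X x⟩).comp x hX

theorem IsSmoothEndo.isSmoothField {A : Endo I M} (hA : IsSmoothEndo A) {X : VField I M}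
    (hX : IsSmoothField X) : IsSmoothField (A.app X) := fun x => hA.smoothFieldAt (hX x)

theorem IsSmoothOneForm.mdifferentiableAt {α : OneForm I M} (hα : IsSmoothOneForm α)
    {X : VField I M} {x : M} (hX : DiffFieldAt X x) :
    MDifferentiableAt I 𝓘(ℝ, ℝ) (fun y => α y (X y)) x :=
  ((hα ⟨x, X x⟩).mdifferentiableAt (by simp)).comp x hX

theorem IsSmoothOneForm.contMDiffAt {α : OneForm I M} (hα : IsSmoothOneForm α)
    {X : VField I M} {x : M} (hX : SmoothFieldAt X x) :
    ContMDiffAt I 𝓘(ℝ, ℝ) ∞ (fun y => α y (X y)) x :=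
  (hα ⟨x, X x⟩).comp x hX

theorem IsSmoothField.diffFieldAt {X : VField I M} (hX : IsSmoothField X) (x : M) :
    DiffFieldAt X x := SmoothFieldAt.diffFieldAt (hX x)

/-- Differentiable `2`-forms: alternating bilinear forms on the tangent spaces that take
differentiable vector fields to differentiable functions. -/
structure IsTwoForm (σ : BilinField I M) : Prop where
  add_left : ∀ x (u v w : TangentSpace I x), σ x (u + v) w = σ x u w + σ x v w
  smul_left : ∀ x (c : ℝ) (u w : TangentSpace I x), σ x (c • u) w = c * σ x u w
  alt : ∀ x (v w : TangentSpace I x), σ x v w = -σ x w v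
  mdifferentiableAt : ∀ x (X Y : VField I M), DiffFieldAt X x → DiffFieldAt Y x →
    MDifferentiableAt I 𝓘(ℝ, ℝ) (fun y => σ y (X y) (Y y)) x

namespace IsTwoForm
variable {σ : BilinField I M} (hσ : IsTwoForm σ)
include hσ

theorem add_right (x : M) (u v w : TangentSpace I x) : σ x w (u + v) = σ x w u + σ x w v := by
  rw [hσ.alt, hσ.add_left, hσ.alt x w u, hσ.alt x w v]; ring

theorem smul_right (x : M) (c : ℝ) (u w : TangentSpace I x) : σ x w (c • u) = c * σ x w u := by
  rw [hσ.alt, hσ.smul_left, hσ.alt x w u]; ring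

theorem neg_left (x : M) (u w : TangentSpace I x) : σ x (-u) w = -σ x u w := by
  rw [← neg_one_smul ℝ, hσ.smul_left]; ring

theorem dTwo_swap_left (X Y Z : VField I M) (x : M) :
    dTwo σ X Y Z x = -dTwo σ Y X Z x := by
  simp only [dTwo]
  have h : (fun y => σ y (Y y) (X y)) = fun y => -σ y (X y) (Y y) := funext fun y => hσ.alt _ _ _
  rw [h, lieFun_neg, mlieBracket_swap_apply (V := Y) (W := X), hσ.neg_left]
  ring

theorem dTwo_swap_right (X Y Z : VField I M) (x : M) :
    dTwo σ X Y Z x = -dTwo σ X Z Y x := by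
  simp only [dTwo]
  have h : (fun y => σ y (Z y) (Y y)) = fun y => -σ y (Y y) (Z y) := funext fun y => hσ.alt _ _ _
  rw [h, lieFun_neg, mlieBracket_swap_apply (V := Z) (W := Y), hσ.neg_left]
  ring

end IsTwoForm

/-- The fundamental form of a skew endomorphism is a `2`-form. -/
theorem isTwoForm_fundForm (g : Metric I M) {A : Endo I M} (hA : IsSmoothEndo A)
    (hskew : ∀ x (v w : TangentSpace I x), g.inner x v (A x w) = -g.inner x w (A x v)) :
    IsTwoForm (fundForm g A) where
  add_left x u v w := by simp [fundForm]
  smul_left x c u w := by simp [fundForm]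
  alt := hskew
  mdifferentiableAt x X Y hX hY := g.mdifferentiableAt_inner hX (hA.diffFieldAt hY)

variable [FiniteDimensional ℝ E]

theorem tensorialAt_nijenhuis {A : Endo I M} (hA : IsSmoothEndo A) (Y : VField I M) (x : M) :
    TensorialAt I E (fun X : VField I M => nijenhuis A X Y x) x where
  smul {f X} hf hX := by
    have : CompleteSpace E := FiniteDimensional.complete ℝ E
    have hAX := hA.diffFieldAt hX
    simp only [nijenhuis, Endo.app_smul]
    rw [mlieBracket_smul_left hf hX, mlieBracket_smul_left hf hX, mlieBracket_smul_left hf hAX,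
      mlieBracket_smul_left hf hAX]
    simp only [map_add, map_smul, Endo.app]
    module
  add {X X'} hX hX' := by
    have : CompleteSpace E := FiniteDimensional.complete ℝ E
    simp only [nijenhuis, Endo.app_add]
    rw [mlieBracket_add_left hX hX', mlieBracket_add_left hX hX',
      mlieBracket_add_left (hA.diffFieldAt hX) (hA.diffFieldAt hX'),
      mlieBracket_add_left (hA.diffFieldAt hX) (hA.diffFieldAt hX')]
    simp only [map_add]
    abel

/-- The torsion at `x` depends only on the values of the two fields at `x`. -/
theorem nijenhuis_congr {A : Endo I M} (hA : IsSmoothEndo A) {X X' Y Y' : VField I M} {x : M}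
    (hX : DiffFieldAt X x) (hX' : DiffFieldAt X' x) (hY : DiffFieldAt Y x)
    (hY' : DiffFieldAt Y' x) (hXX' : X x = X' x) (hYY' : Y x = Y' x) :
    nijenhuis A X Y x = nijenhuis A X' Y' x := by
  rw [(tensorialAt_nijenhuis hA _ _).pointwise hX hX' hXX', nijenhuis_swap,
    (tensorialAt_nijenhuis hA _ _).pointwise hY hY' hYY', ← nijenhuis_swap]

theorem tensorialAt_dOne {α : OneForm I M} (hα : IsSmoothOneForm α) (Y : VField I M) (x : M) :
    TensorialAt I E (fun X : VField I M => dOne α X Y x) x where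
  smul {f X} hf hX := by
    have : CompleteSpace E := FiniteDimensional.complete ℝ E
    simp only [dOne]
    rw [mlieBracket_smul_left hf hX]
    have h1 : (fun y => α y ((f • X) y)) = fun y => f y * α y (X y) :=
      funext fun y => map_smul _ _ _
    rw [h1, lieFun_mul _ hf (hα.mdifferentiableAt hX)]
    simp [lieFun]
    ring
  add {X X'} hX hX' := by
    have : CompleteSpace E := FiniteDimensional.complete ℝ E
    simp only [dOne]
    rw [mlieBracket_add_left hX hX']
    have h1 : (fun y => α y ((X + X') y)) = fun y => α y (X y) + α y (X' y) :=
      funext fun y => map_add _ _ _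
    rw [h1, lieFun_add _ (hα.mdifferentiableAt hX) (hα.mdifferentiableAt hX')]
    simp [lieFun]
    ring

theorem dOne_congr {α : OneForm I M} (hα : IsSmoothOneForm α) {X X' Y Y' : VField I M} {x : M}
    (hX : DiffFieldAt X x) (hX' : DiffFieldAt X' x) (hY : DiffFieldAt Y x)
    (hY' : DiffFieldAt Y' x) (hXX' : X x = X' x) (hYY' : Y x = Y' x) :
    dOne α X Y x = dOne α X' Y' x := by
  rw [(tensorialAt_dOne hα _ _).pointwise hX hX' hXX', dOne_swap,
    (tensorialAt_dOne hα _ _).pointwise hY hY' hYY', ← dOne_swap]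

namespace IsTwoForm
variable {σ : BilinField I M} (hσ : IsTwoForm σ)
include hσ

theorem tensorialAt_dTwo {Y Z : VField I M} {x : M}
    (hY : DiffFieldAt Y x) (hZ : DiffFieldAt Z x) :
    TensorialAt I E (fun X : VField I M => dTwo σ X Y Z x) x where
  smul {f X} hf hX := by
    have : CompleteSpace E := FiniteDimensional.complete ℝ E
    have h1 (W : VField I M) : (fun y => σ y ((f • X) y) (W y)) = fun y => f y * σ y (X y) (W y) :=
      funext fun y => hσ.smul_left _ _ _ _
    have h2 : σ x (mlieBracket I Y Z x) ((f • X) x) = f x * σ x (mlieBracket I Y Z x) (X x) :=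
      hσ.smul_right _ _ _ _
    have h3 (h : M → ℝ) : lieFun (f • X) h x = f x * lieFun X h x := by
      simp [lieFun]
    simp only [dTwo]
    rw [mlieBracket_smul_left hf hX, mlieBracket_smul_left hf hX, h1, h1, h2, h3,
      lieFun_mul _ hf (hσ.mdifferentiableAt _ _ _ hX hZ),
      lieFun_mul _ hf (hσ.mdifferentiableAt _ _ _ hX hY), hσ.add_left, hσ.add_left,
      neg_smul, neg_smul, hσ.neg_left, hσ.neg_left]
    simp only [hσ.smul_left, lieFun, smul_eq_mul]
    rw [hσ.alt x (X x) (Z x), hσ.alt x (X x) (Y x)]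
    ring
  add {X X'} hX hX' := by
    have : CompleteSpace E := FiniteDimensional.complete ℝ E
    have h1 (W : VField I M) : (fun y => σ y ((X + X') y) (W y)) =
        fun y => σ y (X y) (W y) + σ y (X' y) (W y) :=
      funext fun y => hσ.add_left _ _ _ _
    have h2 : σ x (mlieBracket I Y Z x) ((X + X') x) =
        σ x (mlieBracket I Y Z x) (X x) + σ x (mlieBracket I Y Z x) (X' x) :=
      hσ.add_right _ _ _ _
    have h3 (h : M → ℝ) : lieFun (X + X') h x = lieFun X h x + lieFun X' h x := by
      simp [lieFun]
    simp only [dTwo]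
    rw [mlieBracket_add_left hX hX', mlieBracket_add_left hX hX', h1, h1, h2, h3,
      lieFun_add _ (hσ.mdifferentiableAt _ _ _ hX hZ) (hσ.mdifferentiableAt _ _ _ hX' hZ),
      lieFun_add _ (hσ.mdifferentiableAt _ _ _ hX hY) (hσ.mdifferentiableAt _ _ _ hX' hY),
      hσ.add_left, hσ.add_left]
    ring

theorem dTwo_congr {X X' Y Y' Z Z' : VField I M} {x : M}
    (hX : DiffFieldAt X x) (hX' : DiffFieldAt X' x) (hY : DiffFieldAt Y x)
    (hY' : DiffFieldAt Y' x) (hZ : DiffFieldAt Z x) (hZ' : DiffFieldAt Z' x)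
    (hXX' : X x = X' x) (hYY' : Y x = Y' x) (hZZ' : Z x = Z' x) :
    dTwo σ X Y Z x = dTwo σ X' Y' Z' x := by
  rw [(hσ.tensorialAt_dTwo hY hZ).pointwise hX hX' hXX', hσ.dTwo_swap_left,
    (hσ.tensorialAt_dTwo hX' hZ).pointwise hY hY' hYY', hσ.dTwo_swap_right, hσ.dTwo_swap_left,
    (hσ.tensorialAt_dTwo hY' hX').pointwise hZ hZ' hZZ', ← hσ.dTwo_swap_left,
    ← hσ.dTwo_swap_right, ← hσ.dTwo_swap_left]

end IsTwoForm

/-- Every tangent vector is the value of a smooth vector field. -/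
theorem exists_isSmoothField_apply_eq [T2Space M] {x : M} (v : TangentSpace I x) :
    ∃ X : VField I M, IsSmoothField X ∧ X x = v := by
  -- cut off a local extension by a bump function
  obtain ⟨s, hs, hsm⟩ := FiberBundle.exists_contMDiffOn_extend (k := ∞) I E v
  obtain ⟨f, -, hf⟩ := (SmoothBumpFunction.nhds_basis_tsupport (I := I) x).mem_iff.1
    (interior_mem_nhds.2 hs)
  refine ⟨fun y => f y • FiberBundle.extend E v y, fun y => ?_, by simp⟩
  by_cases hy : y ∈ tsupport f
  · have h1 : SmoothFieldAt (FiberBundle.extend E v) y :=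
      hsm.contMDiffAt (mem_interior_iff_mem_nhds.1 (hf hy))
    exact ContMDiffAt.smul_section (f.contMDiff.contMDiffAt) h1
  · have h2 : (fun y => (⟨y, f y • FiberBundle.extend E v y⟩ : TangentBundle I M)) =ᶠ[𝓝 y]
        fun y => ⟨y, 0⟩ := by
      filter_upwards [(isClosed_tsupport f).isOpen_compl.mem_nhds hy] with z hz
      rw [image_eq_zero_of_notMem_tsupport hz, zero_smul]
    exact (contMDiff_zeroSection ℝ
      (fun x : M => TangentSpace I x)).contMDiffAt.congr_of_eventuallyEq h2

end Tensoriality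

/-! ### Lie brackets as commutators of derivations -/

section Derivation

variable {E : Type*} [NormedAddCommGroup E] [NormedSpace ℝ E]
  {H : Type*} [TopologicalSpace H] {I : ModelWithCorners ℝ E H}
  {M : Type*} [TopologicalSpace M] [ChartedSpace H M]
  {E' : Type*} [NormedAddCommGroup E'] [NormedSpace ℝ E']
  {H' : Type*} [TopologicalSpace H'] {I' : ModelWithCorners ℝ E' H'}
  {N : Type*} [TopologicalSpace N] [ChartedSpace H' N]
  {F : Type*} [NormedAddCommGroup F] [NormedSpace ℝ F]

theorem mvfderiv_comp_apply' {g : N → F} {f : M → N} (x : M)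
    (hg : MDifferentiableAt I' 𝓘(ℝ, F) g (f x)) (hf : MDifferentiableAt I I' f x)
    (v : TangentSpace I x) :
    mvfderiv I (fun y => g (f y)) x v = mvfderiv I' g (f x) (mfderiv I I' f x v) :=
  mfderiv_comp_apply x hg hf v

theorem mvfderiv_congr {f g : M → F} {x : M} (h : f =ᶠ[𝓝 x] g) (v : TangentSpace I x) :
    mvfderiv I f x v = mvfderiv I g x v := by
  simp only [mvfderiv, h.mfderiv_eq]
  rfl

/-- The computation behind `mvfderiv_mlieBracket` in a vector space. -/
theorem fderiv_lieBracket {f : E → F} {X Y : E → E} {x : E} (hf : ContDiffAt ℝ ∞ f x)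
    (hX : DifferentiableAt ℝ X x) (hY : DifferentiableAt ℝ Y x) :
    fderiv ℝ f x (lieBracket ℝ X Y x) =
      fderiv ℝ (fun y => fderiv ℝ f y (Y y)) x (X x)
        - fderiv ℝ (fun y => fderiv ℝ f y (X y)) x (Y x) := by
  have hd : DifferentiableAt ℝ (fderiv ℝ f) x :=
    (hf.fderiv_right (m := 1) (by norm_cast)).differentiableAt (by simp)
  have h2 : ((2 : ℕ∞) : WithTop ℕ∞) ≤ ((⊤ : ℕ∞) : WithTop ℕ∞) := WithTop.coe_le_coe.2 le_top
  have hsymm := (hf.isSymmSndFDerivAt (by simpa using h2)) (X x) (Y x)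
  rw [fderiv_clm_apply hd hY, fderiv_clm_apply hd hX]
  simp only [lieBracket, map_sub, add_apply, ContinuousLinearMap.comp_apply,
    ContinuousLinearMap.flip_apply]
  rw [hsymm]
  abel

variable [IsManifold I ∞ M]

theorem SmoothFieldAt.contMDiffAt_mvfderiv {f : M → F} {s : Set M} {x : M} {Y : VField I M}
    (hY : SmoothFieldAt Y x) (hs : IsOpen s) (hx : x ∈ s) (hf : ContMDiffOn I 𝓘(ℝ, F) ∞ f s) :
    ContMDiffAt I 𝓘(ℝ, F) ∞ (fun y => mvfderiv I f y (Y y)) x := by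
  have h1 := hf.contMDiffOn_tangentMapWithin (m := ∞) (by simp) hs.uniqueMDiffOn
  have h2 : ContMDiffAt I.tangent 𝓘(ℝ, F).tangent ∞ (tangentMapWithin I 𝓘(ℝ, F) f s) ⟨x, Y x⟩ :=
    h1.contMDiffAt ((hs.preimage (FiberBundle.continuous_proj E (TangentSpace I))).mem_nhds hx)
  refine (((contMDiff_snd_tangentBundle_modelSpace F 𝓘(ℝ, F)).contMDiffAt).comp x
    (h2.comp x hY)).congr_of_eventuallyEq ?_
  filter_upwards [hs.mem_nhds hx] with y hy
  change (mfderiv I 𝓘(ℝ, F) f y) (Y y) = (mfderivWithin I 𝓘(ℝ, F) f s y) (Y y)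
  rw [mfderivWithin_of_isOpen hs hy]

variable [I.Boundaryless] [CompleteSpace E]

/-- The Lie bracket acts on functions as the commutator of derivations. -/
theorem mvfderiv_mlieBracket {f : M → F} {X Y : VField I M} {x : M}
    (hf : ∀ᶠ y in 𝓝 x, ContMDiffAt I 𝓘(ℝ, F) ∞ f y)
    (hX : DiffFieldAt X x) (hY : DiffFieldAt Y x) :
    mvfderiv I f x (mlieBracket I X Y x) =
      mvfderiv I (fun y => mvfderiv I f y (Y y)) x (X x)
        - mvfderiv I (fun y => mvfderiv I f y (X y)) x (Y x) := by
  -- both sides are transported to the model space by the chart `c` at `x`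
  set c := extChartAt I x with hc
  let pb : VField I M → E → E := fun Z => mpullbackWithin 𝓘(ℝ, E) I c.symm Z (Set.range I)
  let f' : E → F := fun z => f (c.symm z)
  have hcd : ∀ᶠ y in 𝓝 x, y ∈ c.source := extChartAt_source_mem_nhds (I := I) x
  have hcm : ∀ y ∈ c.source, MDifferentiableAt I 𝓘(ℝ, E) c y := fun y hy =>
    mdifferentiableAt_extChartAt (by simpa [hc] using hy)
  have hcs : ∀ z ∈ c.target, ContMDiffAt 𝓘(ℝ, E) I ∞ c.symm z := fun z hz =>
    (contMDiffOn_extChartAt_symm x).contMDiffAt ((isOpen_extChartAt_target x).mem_nhds hz)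
  have hf' : ∀ᶠ y in 𝓝 x, ContDiffAt ℝ ∞ f' (c y) := by
    filter_upwards [hf, hcd] with y hy hys
    rw [← contMDiffAt_iff_contDiffAt]
    have h1 : ContMDiffAt I 𝓘(ℝ, F) ∞ f (c.symm (c y)) := by rwa [c.left_inv hys]
    exact h1.comp (c y) (hcs _ (c.map_source hys))
  have hpb : ∀ (Z : VField I M), ∀ᶠ y in 𝓝 x, mfderiv I 𝓘(ℝ, E) c y (Z y) = pb Z (c y) := by
    intro Z
    have h1 := eventuallyEq_mpullback_mpullbackWithin_extChartAt (I := I) (s := Set.univ) (x := x) Z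
    rw [nhdsWithin_univ] at h1
    filter_upwards [h1, hcd] with y hy hys
    rw [hy, mpullback_apply]
    have hi := isInvertible_mfderiv_extChartAt (I := I) hys
    exact hi.self_apply_inverse _
  have hdf : ∀ᶠ y in 𝓝 x, ∀ v : TangentSpace I y,
      mvfderiv I f y v = fderiv ℝ f' (c y) (mfderiv I 𝓘(ℝ, E) c y v) := by
    filter_upwards [hf', hcd, hcd.eventually_nhds] with y hy hys hev v
    have h1 : f =ᶠ[𝓝 y] fun y => f' (c y) := by
      filter_upwards [hev] with z hz
      simp [f', c.left_inv hz]
    rw [mvfderiv_congr h1, mvfderiv_comp_apply' (I' := 𝓘(ℝ, E)) y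
      (hy.differentiableAt (by simp)).mdifferentiableAt (hcm y hys)]
    simp only [mvfderiv, mfderiv_eq_fderiv]
    rfl
  have hlie : ∀ Z : VField I M, ∀ᶠ y in 𝓝 x, mvfderiv I f y (Z y)
      = (fun z => fderiv ℝ f' z (pb Z z)) (c y) := by
    intro Z
    filter_upwards [hdf, hpb Z] with y h1 h2
    rw [h1, h2]
  have hxs : x ∈ c.source := mem_extChartAt_source x
  have hset : c.symm ⁻¹' Set.univ ∩ Set.range I = Set.univ := by
    rw [I.range_eq_univ, Set.preimage_univ, Set.inter_univ]
  have hdiff : ∀ Z : VField I M, DiffFieldAt Z x → DifferentiableAt ℝ (pb Z) (c x) := by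
    intro Z hZ
    have hZ' : DifferentiableWithinAt ℝ (pb Z) (c.symm ⁻¹' Set.univ ∩ Set.range I) (c x) :=
      MDifferentiableWithinAt.differentiableWithinAt_mpullbackWithin_vectorField
      (I := I) (s := Set.univ) (V := Z) (x := x) (mdifferentiableWithinAt_univ.2 hZ)
    rwa [hset, differentiableWithinAt_univ] at hZ'
  have hd' : DifferentiableAt ℝ (fderiv ℝ f') (c x) :=
    (hf'.self_of_nhds.fderiv_right (m := 1) (by norm_cast)).differentiableAt (by simp)
  have hsecond : ∀ Z W : VField I M, DiffFieldAt Z x → 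
      mvfderiv I (fun y => mvfderiv I f y (Z y)) x (W x) =
        fderiv ℝ (fun z => fderiv ℝ f' z (pb Z z)) (c x) (pb W (c x)) := by
    intro Z W hZ
    rw [mvfderiv_congr (hlie Z), mvfderiv_comp_apply' (I' := 𝓘(ℝ, E)) x
      (hd'.clm_apply (hdiff Z hZ)).mdifferentiableAt (hcm x hxs), (hpb W).self_of_nhds]
    simp only [mvfderiv, mfderiv_eq_fderiv]
    rfl
  have hbr : mfderiv I 𝓘(ℝ, E) c x (mlieBracket I X Y x) = lieBracket ℝ (pb X) (pb Y) (c x) := by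
    rw [← mlieBracketWithin_univ, mlieBracketWithin_apply]
    have hi := isInvertible_mfderiv_extChartAt (I := I) hxs
    refine (hi.self_apply_inverse _).trans ?_
    change lieBracketWithin ℝ (pb X) (pb Y) (c.symm ⁻¹' Set.univ ∩ Set.range I) (c x) = _
    rw [hset, lieBracketWithin_univ]
  rw [hsecond Y X hY, hsecond X Y hX, hdf.self_of_nhds, hbr]
  exact fderiv_lieBracket hf'.self_of_nhds (hdiff X hX) (hdiff Y hY)

end Derivation

/-! ### The product with the line -/

section ProductBasics

variable {E : Type*} [NormedAddCommGroup E] [NormedSpace ℝ E]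
  {H : Type*} [TopologicalSpace H] {I : ModelWithCorners ℝ E H}
  {M : Type*} [TopologicalSpace M] [ChartedSpace H M]

theorem prM_eq (p : M × ℝ) (v : TangentSpace (I.prod 𝓘(ℝ, ℝ)) p) : prM p v = v.1 := by
  simp only [prM, mfderiv_fst]; rfl

theorem dt_eq (p : M × ℝ) (v : TangentSpace (I.prod 𝓘(ℝ, ℝ)) p) : dt p v = v.2 := by
  simp only [dt, mvfderiv, mfderiv_snd]; rfl

theorem inclM_eq (p : M × ℝ) (w : TangentSpace I p.1) : inclM p w = (w, (0 : ℝ)) := by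
  simp only [inclM, mfderiv_prod_left]; rfl

theorem ddt_eq (p : M × ℝ) : (ddt p : TangentSpace (I.prod 𝓘(ℝ, ℝ)) p) = ((0 : E), (1 : ℝ)) := by
  simp only [ddt, mfderiv_prod_right]; rfl

@[simp] theorem prM_inclM (p : M × ℝ) (w : TangentSpace I p.1) : prM p (inclM p w) = w := by
  rw [prM_eq, inclM_eq]

@[simp] theorem dt_inclM (p : M × ℝ) (w : TangentSpace I p.1) : dt p (inclM p w) = 0 := by
  rw [dt_eq, inclM_eq]

@[simp] theorem prM_ddt (p : M × ℝ) : prM p (ddt p : TangentSpace (I.prod 𝓘(ℝ, ℝ)) p) = 0 := by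
  rw [prM_eq, ddt_eq]; rfl

@[simp] theorem dt_ddt (p : M × ℝ) : dt p (ddt p : TangentSpace (I.prod 𝓘(ℝ, ℝ)) p) = 1 := by
  rw [dt_eq, ddt_eq]

theorem ext_prM_dt {p : M × ℝ} {v w : TangentSpace (I.prod 𝓘(ℝ, ℝ)) p} (h₁ : prM p v = prM p w)
    (h₂ : dt p v = dt p w) : v = w := by
  rw [prM_eq, prM_eq] at h₁
  rw [dt_eq, dt_eq] at h₂
  exact Prod.ext h₁ h₂

theorem inclM_prM_add_dt (p : M × ℝ) (v : TangentSpace (I.prod 𝓘(ℝ, ℝ)) p) :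
    inclM p (prM p v) + dt p v • ddt p = v :=
  ext_prM_dt (by simp) (by simp)

theorem lieFun_comp_fst_add_const {X : VField (I.prod 𝓘(ℝ, ℝ)) (M × ℝ)} {W : VField I M}
    {p : M × ℝ} (hX : prM p (X p) = W p.1) {f : M → ℝ} (hf : MDifferentiableAt I 𝓘(ℝ, ℝ) f p.1)
    (k : ℝ) : lieFun X (fun q : M × ℝ => f q.1 + k) p = lieFun W f p.1 := by
  have hf' : MDifferentiableAt (I.prod 𝓘(ℝ, ℝ)) 𝓘(ℝ, ℝ) (fun q : M × ℝ => f q.1) p :=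
    hf.comp p mdifferentiableAt_fst
  rw [lieFun_add _ hf' mdifferentiableAt_const, lieFun_const, add_zero]
  simp only [lieFun]
  rw [mvfderiv_comp_apply' (I' := I) p hf mdifferentiableAt_fst]
  exact congrArg _ hX

variable [IsManifold I ∞ M]

theorem smoothFieldAt_inclM {w : Π q : M × ℝ, TangentSpace I q.1} {p : M × ℝ}
    (hw : ContMDiffAt (I.prod 𝓘(ℝ, ℝ)) I.tangent ∞
      (fun q => (⟨q.1, w q⟩ : TangentBundle I M)) p) :
    SmoothFieldAt (I := I.prod 𝓘(ℝ, ℝ)) (fun q : M × ℝ => inclM q (w q)) p := by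
  have h0 : ContMDiffAt (I.prod 𝓘(ℝ, ℝ)) 𝓘(ℝ, ℝ).tangent ∞
      (fun q : M × ℝ => (⟨q.2, 0⟩ : TangentBundle 𝓘(ℝ, ℝ) ℝ)) p :=
    ((contMDiff_zeroSection ℝ (fun x : ℝ => TangentSpace 𝓘(ℝ, ℝ) x)).contMDiffAt).comp p
      contMDiffAt_snd
  refine (((contMDiff_equivTangentBundleProd_symm (I := I) (I' := 𝓘(ℝ, ℝ)) (n := ∞)
    (M := M) (M' := ℝ)) _).comp p (hw.prodMk h0)).congr_of_eventuallyEq (.of_forall fun q => ?_)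
  simp only [inclM_eq]
  rfl

theorem isSmoothField_liftField {X : VField I M} (hX : IsSmoothField X) :
    IsSmoothField (liftField X) := fun p =>
  smoothFieldAt_inclM ((hX p.1).comp p contMDiffAt_fst)

theorem isSmoothField_ddt : IsSmoothField (ddt : VField (I.prod 𝓘(ℝ, ℝ)) (M × ℝ)) := by
  intro p
  have h1 : ContMDiffAt 𝓘(ℝ, ℝ) 𝓘(ℝ, ℝ).tangent ∞
      (fun t : ℝ => (⟨t, (1 : ℝ)⟩ : TangentBundle 𝓘(ℝ, ℝ) ℝ)) p.2 := by
    exact contMDiff_vectorSpace_iff_contDiff.2 contDiff_const _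
  have h0 : ContMDiffAt (I.prod 𝓘(ℝ, ℝ)) I.tangent ∞
      (fun q : M × ℝ => (⟨q.1, 0⟩ : TangentBundle I M)) p :=
    ((contMDiff_zeroSection ℝ (fun x : M => TangentSpace I x)).contMDiffAt).comp p
      contMDiffAt_fst
  refine (((contMDiff_equivTangentBundleProd_symm (I := I) (I' := 𝓘(ℝ, ℝ)) (n := ∞)
    (M := M) (M' := ℝ)) _).comp p (h0.prodMk (h1.comp p contMDiffAt_snd))).congr_of_eventuallyEq
      (.of_forall fun q => ?_)
  simp only [ddt_eq]
  rfl

theorem contMDiffAt_prM {X : VField (I.prod 𝓘(ℝ, ℝ)) (M × ℝ)} {p : M × ℝ}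
    (hX : SmoothFieldAt X p) :
    ContMDiffAt (I.prod 𝓘(ℝ, ℝ)) I.tangent ∞
      (fun q => (⟨q.1, prM q (X q)⟩ : TangentBundle I M)) p :=
  ((contMDiff_fst (I := I) (J := 𝓘(ℝ, ℝ)) (n := ∞)).contMDiff_tangentMap (m := ∞)
    (by simp) ⟨p, X p⟩).comp p hX

theorem contMDiffAt_dt {X : VField (I.prod 𝓘(ℝ, ℝ)) (M × ℝ)} {p : M × ℝ}
    (hX : SmoothFieldAt X p) :
    ContMDiffAt (I.prod 𝓘(ℝ, ℝ)) 𝓘(ℝ, ℝ) ∞ (fun q => dt q (X q)) p := by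
  have h := ((contMDiff_snd (I := I) (J := 𝓘(ℝ, ℝ)) (M := M) (N := ℝ)
    (n := ∞)).contMDiff_tangentMap (m := ∞) (by simp) ⟨p, X p⟩).comp p hX
  exact ((contMDiff_snd_tangentBundle_modelSpace ℝ 𝓘(ℝ, ℝ)).contMDiffAt).comp p h

variable [I.Boundaryless] [CompleteSpace E]

/-- To recognise a Lie bracket `[X, Y]` on `M × ℝ`, its `M`-component is tested on functions
pulled back from a chart of `M`, and its `ℝ`-component on the coordinate `t`. -/
theorem mlieBracket_prod_eq {X Y : VField (I.prod 𝓘(ℝ, ℝ)) (M × ℝ)} (hX : IsSmoothField X)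
    (hY : IsSmoothField Y) {cX cY : ℝ} (htX : ∀ q, dt q (X q) = cX) (htY : ∀ q, dt q (Y q) = cY)
    {X' Y' : VField I M} (hX' : IsSmoothField X') (hY' : IsSmoothField Y')
    (hpX : ∀ q, prM q (X q) = X' q.1) (hpY : ∀ q, prM q (Y q) = Y' q.1) (p : M × ℝ) :
    mlieBracket (I.prod 𝓘(ℝ, ℝ)) X Y p = inclM p (mlieBracket I X' Y' p.1) := by
  have hXp := hX.diffFieldAt p
  have hYp := hY.diffFieldAt p
  refine ext_prM_dt ?_ ?_
  · rw [prM_inclM]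
    set c := extChartAt I p.1 with hc
    have hcs : IsOpen c.source := isOpen_extChartAt_source p.1
    have hpc : p.1 ∈ c.source := mem_extChartAt_source p.1
    have hcm : ContMDiffOn I 𝓘(ℝ, E) ∞ c c.source := by
      rw [hc, extChartAt_source]
      exact contMDiffOn_extChartAt
    have hev : ∀ᶠ q : M × ℝ in 𝓝 p, q.1 ∈ c.source :=
      (continuous_fst.tendsto p).eventually (hcs.mem_nhds hpc)
    have hd : ∀ᶠ q : M × ℝ in 𝓝 p, ∀ v : TangentSpace (I.prod 𝓘(ℝ, ℝ)) q,
        mvfderiv (I.prod 𝓘(ℝ, ℝ)) (fun q : M × ℝ => c q.1) q v = mvfderiv I c q.1 (prM q v) := by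
      filter_upwards [hev] with q hq v
      exact mvfderiv_comp_apply' (I' := I) q
        ((hcm.contMDiffAt (hcs.mem_nhds hq)).mdifferentiableAt (by simp)) mdifferentiableAt_fst v
    have hf : ∀ᶠ q : M × ℝ in 𝓝 p,
        ContMDiffAt (I.prod 𝓘(ℝ, ℝ)) 𝓘(ℝ, E) ∞ (fun q : M × ℝ => c q.1) q := by
      filter_upwards [hev] with q hq
      exact (hcm.contMDiffAt (hcs.mem_nhds hq)).comp q contMDiffAt_fst
    have key : ∀ (Z W : VField (I.prod 𝓘(ℝ, ℝ)) (M × ℝ)) (Z' W' : VField I M),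
        IsSmoothField Z' → (∀ q, prM q (Z q) = Z' q.1) → (∀ q, prM q (W q) = W' q.1) →
        mvfderiv (I.prod 𝓘(ℝ, ℝ))
          (fun q => mvfderiv (I.prod 𝓘(ℝ, ℝ)) (fun q : M × ℝ => c q.1) q (Z q)) p (W p) =
        mvfderiv I (fun x => mvfderiv I c x (Z' x)) p.1 (W' p.1) := by
      intro Z W Z' W' hZ' hZ hW
      have h1 : (fun q => mvfderiv (I.prod 𝓘(ℝ, ℝ)) (fun q : M × ℝ => c q.1) q (Z q)) =ᶠ[𝓝 p]
          fun q => (fun x => mvfderiv I c x (Z' x)) q.1 := by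
        filter_upwards [hd] with q hq
        rw [hq, hZ]
      rw [mvfderiv_congr h1, mvfderiv_comp_apply' (I' := I)
        (g := fun x => mvfderiv I c x (Z' x)) (f := Prod.fst) p
        ((SmoothFieldAt.contMDiffAt_mvfderiv (hZ' p.1) hcs hpc hcm).mdifferentiableAt (by simp))
        mdifferentiableAt_fst]
      exact congrArg _ (hW p)
    have h1 := mvfderiv_mlieBracket hf hXp hYp
    rw [hd.self_of_nhds, key Y X Y' X' hY' hpY hpX, key X Y X' Y' hX' hpX hpY,
      ← mvfderiv_mlieBracket (eventually_of_mem (hcs.mem_nhds hpc)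
        fun y hy => hcm.contMDiffAt (hcs.mem_nhds hy)) (hX'.diffFieldAt _)
        (hY'.diffFieldAt _)] at h1
    exact (isInvertible_mfderiv_extChartAt (I := I) hpc).injective h1
  · rw [dt_inclM]
    have h1 := mvfderiv_mlieBracket (f := (Prod.snd : M × ℝ → ℝ)) (x := p)
      (.of_forall fun q => contMDiffAt_snd) hXp hYp
    have h2 : ∀ Z : VField (I.prod 𝓘(ℝ, ℝ)) (M × ℝ), ∀ c : ℝ, (∀ q, dt q (Z q) = c) →
        (fun q => mvfderiv (I.prod 𝓘(ℝ, ℝ)) (Prod.snd : M × ℝ → ℝ) q (Z q)) = fun _ => c :=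
      fun Z c h => funext h
    rw [h2 Y cY htY, h2 X cX htX, mvfderiv_const, mvfderiv_const] at h1
    simpa [dt] using h1

end ProductBasics

/-! ### Quasi-Vaisman structures -/

section Vaisman

variable {E : Type*} [NormedAddCommGroup E] [NormedSpace ℝ E]
  {H : Type*} [TopologicalSpace H] {I : ModelWithCorners ℝ E H}
  {M : Type*} [TopologicalSpace M] [ChartedSpace H M]

theorem lee_apply {J : Endo I M} {θ : OneForm I M} (x : M) (v : TangentSpace I x) :
    θ x (J x v) = -antiLee J θ x v := by
  simp [antiLee]

variable [IsManifold I ∞ M]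

/-- Smooth vector fields on which `θ` and `η = -θ ∘ J` are constant, with values `a` and `b`.
These suffice for tensorial identities, and for them all derivatives of `θ` and `η` drop out. -/
structure IsAdapted (J : Endo I M) (θ : OneForm I M) (W : VField I M) (a b : ℝ) : Prop where
  smooth : IsSmoothField W
  lee : ∀ x, θ x (W x) = a
  antiLee : ∀ x, antiLee J θ x (W x) = b

theorem dOne_antiLee_of_isAdapted {J : Endo I M} {θ : OneForm I M}
    {W W' : VField I M} {a b a' b' : ℝ} (hW : IsAdapted J θ W a b)
    (hW' : IsAdapted J θ W' a' b') (x : M) :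
    dOne (antiLee J θ) W W' x = -antiLee J θ x (mlieBracket I W W' x) := by
  simp only [dOne, hW.antiLee, hW'.antiLee, lieFun_const]
  ring

theorem Metric.ext_inner (g : Metric I M) {x : M} {u v : TangentSpace I x}
    (h : ∀ w, g.inner x u w = g.inner x v w) : u = v := by
  by_contra hne
  have h1 := g.pos x (u - v) (sub_ne_zero.2 hne)
  rw [map_sub (g.inner x) u v, sub_apply, h, sub_self] at h1
  exact lt_irrefl _ h1

variable [FiniteDimensional ℝ E]

namespace IsQuasiVaisman

variable {J : Endo I M} {g : Metric I M} {θ : OneForm I M} (hM : IsQuasiVaisman J g θ)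
include hM

theorem inner_apply_left (x : M) (v w : TangentSpace I x) :
    g.inner x (J x v) w = -g.inner x v (J x w) := by
  rw [← hM.hermitian.orthogonal x (J x v) w, hM.hermitian.sq]
  simp

theorem apply_metricDual (x : M) : J x (metricDual g θ x) = metricDual g (antiLee J θ) x := by
  refine g.ext_inner fun w => ?_
  rw [hM.inner_apply_left, inner_metricDual, inner_metricDual]
  simp [antiLee]

theorem apply_metricDual_antiLee (x : M) :
    J x (metricDual g (antiLee J θ) x) = -metricDual g θ x := by
  rw [← hM.apply_metricDual, hM.hermitian.sq]

theorem antiLee_apply (x : M) (v : TangentSpace I x) : antiLee J θ x (J x v) = θ x v := by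
  simp [antiLee, hM.hermitian.sq]

theorem lee_metricDual (x : M) : θ x (metricDual g θ x) = 1 := by
  rw [← inner_metricDual g, hM.unit]

theorem lee_metricDual_antiLee (x : M) : θ x (metricDual g (antiLee J θ) x) = 0 := by
  have h1 : θ x (metricDual g (antiLee J θ) x) = antiLee J θ x (metricDual g θ x) := by
    rw [← inner_metricDual g, g.symm, inner_metricDual]
  have h2 : antiLee J θ x (metricDual g θ x) = -θ x (metricDual g (antiLee J θ) x) := by
    rw [← hM.apply_metricDual, lee_apply, neg_neg]
  linarith

theorem antiLee_metricDual (x : M) : antiLee J θ x (metricDual g θ x) = 0 := by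
  have := lee_apply (J := J) (θ := θ) x (metricDual g θ x)
  rw [hM.apply_metricDual, hM.lee_metricDual_antiLee] at this
  linarith

theorem antiLee_metricDual_antiLee (x : M) :
    antiLee J θ x (metricDual g (antiLee J θ) x) = 1 := by
  rw [← hM.apply_metricDual, hM.antiLee_apply, hM.lee_metricDual]

theorem isSmoothOneForm_antiLee : IsSmoothOneForm (antiLee J θ) := by
  have h : ContMDiff I.tangent 𝓘(ℝ, ℝ) ∞ (fun v : TangentBundle I M => θ v.1 (J v.1 v.2)) :=
    hM.smooth.comp hM.hermitian.smooth
  refine h.neg.congr fun v => ?_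
  simp [antiLee]

theorem isSmoothField_lee : IsSmoothField (metricDual g θ) := isSmoothField_metricDual g hM.smooth

theorem isSmoothField_antiLee : IsSmoothField (metricDual g (antiLee J θ)) :=
  isSmoothField_metricDual g hM.isSmoothOneForm_antiLee

theorem isAdapted_lee : IsAdapted J θ (metricDual g θ) 1 0 :=
  ⟨hM.isSmoothField_lee, hM.lee_metricDual, hM.antiLee_metricDual⟩

theorem isAdapted_antiLee : IsAdapted J θ (metricDual g (antiLee J θ)) 0 1 :=
  ⟨hM.isSmoothField_antiLee, hM.lee_metricDual_antiLee, hM.antiLee_metricDual_antiLee⟩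

theorem isAdapted_app {W : VField I M} {a b : ℝ} (hW : IsAdapted J θ W a b) :
    IsAdapted J θ (J.app W) (-b) a :=
  ⟨hM.hermitian.smooth.isSmoothField hW.smooth, fun x => by rw [Endo.app, lee_apply, hW.antiLee],
    fun x => by rw [Endo.app, hM.antiLee_apply, hW.lee]⟩

/-- Correct a global extension of `w` by multiples of the orthonormal fields `U` and `V`. -/
theorem exists_isAdapted [T2Space M] {x : M} (w : TangentSpace I x) :
    ∃ W, IsAdapted J θ W (θ x w) (antiLee J θ x w) ∧ W x = w := by
  obtain ⟨X, hX, rfl⟩ := exists_isSmoothField_apply_eq w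
  set U := metricDual g θ
  set V := metricDual g (antiLee J θ)
  let W : VField I M := fun y =>
    X y + (θ x (X x) - θ y (X y)) • U y + (antiLee J θ x (X x) - antiLee J θ y (X y)) • V y
  refine ⟨W, ⟨fun y => ?_, fun y => ?_, fun y => ?_⟩, by simp [W]⟩
  · have h1 := (contMDiffAt_const (c := θ x (X x))).sub (hM.smooth.contMDiffAt (hX y))
    have h2 := (contMDiffAt_const (c := antiLee J θ x (X x))).sub
      (hM.isSmoothOneForm_antiLee.contMDiffAt (hX y))
    exact ((hX y).add_section (h1.smul_section (hM.isSmoothField_lee y))).add_section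
      (h2.smul_section (hM.isSmoothField_antiLee y))
  · simp [W, U, V, hM.lee_metricDual, hM.lee_metricDual_antiLee]
  · simp [W, U, V, hM.antiLee_metricDual, hM.antiLee_metricDual_antiLee]

theorem lee_mlieBracket {W W' : VField I M} {a b a' b' : ℝ} (hW : IsAdapted J θ W a b)
    (hW' : IsAdapted J θ W' a' b') (x : M) : θ x (mlieBracket I W W' x) = 0 := by
  have h := hM.closed W W' hW.smooth hW'.smooth x
  simp only [dOne, hW.lee, hW'.lee, lieFun_const] at h
  linarith

theorem mlieBracket_lee_app {W : VField I M} (hW : IsSmoothField W) (x : M) :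
    mlieBracket I (metricDual g θ) (J.app W) x = J x (mlieBracket I (metricDual g θ) W x) :=
  sub_eq_zero.1 (hM.holomorphic W hW x)

theorem app_lee : J.app (metricDual g θ) = metricDual g (antiLee J θ) :=
  funext hM.apply_metricDual

/-- The anti-Lee field `V = J U` is holomorphic as well: this is `N_J (U, W) = 0`. -/
theorem mlieBracket_antiLee_app {W : VField I M} (hW : IsSmoothField W) (x : M) :
    mlieBracket I (metricDual g (antiLee J θ)) (J.app W) x =
      J x (mlieBracket I (metricDual g (antiLee J θ)) W x) := by
  have h := hM.hermitian.integrable _ W hM.isSmoothField_lee hW x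
  simp only [nijenhuis, hM.app_lee] at h
  rw [hM.mlieBracket_lee_app hW, map_add] at h
  have h2 := sub_eq_zero.2 h
  rw [← sub_eq_zero]
  rw [← h]
  abel

theorem mlieBracket_lee_antiLee (x : M) :
    mlieBracket I (metricDual g θ) (metricDual g (antiLee J θ)) x = 0 := by
  rw [← hM.app_lee, hM.mlieBracket_lee_app hM.isSmoothField_lee, mlieBracket_self]
  simp

/-- Apply `θ` to `[U, J W] = J [U, W]`. -/
theorem antiLee_mlieBracket_lee {W : VField I M} {a b : ℝ} (hW : IsAdapted J θ W a b) (x : M) :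
    antiLee J θ x (mlieBracket I (metricDual g θ) W x) = 0 := by
  have h := hM.lee_mlieBracket hM.isAdapted_lee (hM.isAdapted_app hW) x
  rw [hM.mlieBracket_lee_app hW.smooth, lee_apply] at h
  linarith

theorem antiLee_mlieBracket_antiLee {W : VField I M} {a b : ℝ} (hW : IsAdapted J θ W a b)
    (x : M) : antiLee J θ x (mlieBracket I (metricDual g (antiLee J θ)) W x) = 0 := by
  have h := hM.lee_mlieBracket hM.isAdapted_antiLee (hM.isAdapted_app hW) x
  rw [hM.mlieBracket_antiLee_app hW.smooth, lee_apply] at h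
  linarith

/-- `dη` is of type `(1,1)`: apply the closed form `θ` to `N_J (W, W') = 0`. -/
theorem antiLee_mlieBracket_app_add {W W' : VField I M} {a b a' b' : ℝ}
    (hW : IsAdapted J θ W a b) (hW' : IsAdapted J θ W' a' b') (x : M) :
    antiLee J θ x (mlieBracket I (J.app W) W' x + mlieBracket I W (J.app W') x) = 0 := by
  have h := congrArg (θ x) (hM.hermitian.integrable W W' hW.smooth hW'.smooth x)
  simp only [nijenhuis, hM.hermitian.sq, map_add, map_sub, map_neg, map_zero,
    lee_apply, hM.lee_mlieBracket hW hW',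
    hM.lee_mlieBracket (hM.isAdapted_app hW) (hM.isAdapted_app hW')] at h
  rw [map_add]
  linarith

end IsQuasiVaisman

end Vaisman

/-! ### The almost contact metric structure on the product -/

section MetricConstruction

/-- The open unit ball of a positive definite form on a finite-dimensional space is bounded. -/
theorem isVonNBounded_of_posDef {F : Type*} [NormedAddCommGroup F] [NormedSpace ℝ F]
    [FiniteDimensional ℝ F] (b : F →L[ℝ] F →L[ℝ] ℝ) (hb : ∀ v, v ≠ 0 → 0 < b v v) :
    Bornology.IsVonNBounded ℝ {v : F | b v v < 1} := by
  rcases subsingleton_or_nontrivial F with hF | hF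
  · exact (NormedSpace.isVonNBounded_iff ℝ).2 (Set.toFinite _).isBounded
  have hcont : Continuous fun v => b v v := by fun_prop
  obtain ⟨v₀, hv₀, hmin⟩ := (isCompact_sphere (0 : F) 1).exists_isMinOn
    (NormedSpace.sphere_nonempty.2 zero_le_one) hcont.continuousOn
  have hv₀' : v₀ ≠ 0 := by
    rintro rfl
    simp at hv₀
  -- `c` is the minimum of the form on the unit sphere
  set c := b v₀ v₀ with hc
  have hc0 : 0 < c := hb v₀ hv₀'
  have hle : ∀ v, c * ‖v‖ ^ 2 ≤ b v v := by
    intro v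
    by_cases hv : v = 0
    · simp [hv]
    have hn : 0 < ‖v‖ := norm_pos_iff.2 hv
    have h1 := hmin (show ‖v‖⁻¹ • v ∈ Metric.sphere (0 : F) 1 by
      simp [norm_smul, hn.ne'])
    simp only [Set.mem_ofPred_eq, map_smul, smul_apply, smul_eq_mul] at h1
    calc c * ‖v‖ ^ 2 ≤ (‖v‖⁻¹ * (‖v‖⁻¹ * b v v)) * ‖v‖ ^ 2 := by gcongr
      _ = b v v := by field_simp
  rw [NormedSpace.isVonNBounded_iff]
  refine (Metric.isBounded_closedBall (x := (0 : F)) (r := √(1 / c))).subset fun v hv => ?_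
  rw [mem_closedBall_zero_iff]
  apply Real.le_sqrt_of_sq_le
  rw [le_div_iff₀ hc0, mul_comm]
  exact (hle v).trans (le_of_lt hv)

variable {E : Type*} [NormedAddCommGroup E] [NormedSpace ℝ E] [FiniteDimensional ℝ E]
  {H : Type*} [TopologicalSpace H] {I : ModelWithCorners ℝ E H}
  {M : Type*} [TopologicalSpace M] [ChartedSpace H M] [IsManifold I ∞ M]

/-- A Riemannian metric from a field of inner products that sends smooth vector fields to smooth
functions. -/
def Metric.ofBilin (B : Π x : M, TangentSpace I x →L[ℝ] TangentSpace I x →L[ℝ] ℝ)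
    (symm : ∀ x v w, B x v w = B x w v) (pos : ∀ x v, v ≠ 0 → 0 < B x v v)
    (smooth : ∀ x (X Y : VField I M), SmoothFieldAt X x → SmoothFieldAt Y x →
      ContMDiffAt I 𝓘(ℝ, ℝ) ∞ (fun y => B y (X y) (Y y)) x) : Metric I M where
  inner := B
  symm := symm
  pos := pos
  isVonNBounded x := isVonNBounded_of_posDef (F := E) (B x) (pos x)
  contMDiff := contMDiff_bilin_of_apply B smooth

variable (g : Metric I M)

/-- The metric `g + dt ⊗ dt` on `M × ℝ`. -/
def Metric.prod : Metric (I.prod 𝓘(ℝ, ℝ)) (M × ℝ) :=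
  Metric.ofBilin
    (fun p => ((prM p).precomp ℝ) ∘L (g.inner p.1) ∘L (prM p) + (dt p).smulRight (dt p))
    (fun p v w => by simp [g.symm p.1 (prM p v), mul_comm])
    (fun p v hv => by
      simp only [add_apply, ContinuousLinearMap.comp_apply, ContinuousLinearMap.precomp_apply,
        ContinuousLinearMap.smulRight_apply, smul_apply, smul_eq_mul]
      by_cases h : prM p v = 0
      · have h2 : dt p v ≠ 0 := fun h3 => hv (ext_prM_dt (by simpa using h) (by simpa using h3))
        rw [h]
        simpa using h2
      · nlinarith [g.pos p.1 _ h, mul_self_nonneg (dt p v)])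
    (fun p X Y hX hY =>
      (g.contMDiffAt_inner (contMDiffAt_prM hX) (contMDiffAt_prM hY)).add
        ((contMDiffAt_dt hX).mul (contMDiffAt_dt hY)))

theorem Metric.prod_inner (p : M × ℝ) (v w : TangentSpace (I.prod 𝓘(ℝ, ℝ)) p) :
    g.prod.inner p v w = g.inner p.1 (prM p v) (prM p w) + dt p v * dt p w := by
  simp [Metric.prod, Metric.ofBilin]

end MetricConstruction

section ProductStructure

variable {E : Type*} [NormedAddCommGroup E] [NormedSpace ℝ E] [FiniteDimensional ℝ E]
  {H : Type*} [TopologicalSpace H] {I : ModelWithCorners ℝ E H}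
  {M : Type*} [TopologicalSpace M] [ChartedSpace H M] [IsManifold I ∞ M]
  {J : Endo I M} {g : Metric I M} {θ : OneForm I M}

/-- The endomorphism `φ` of `T (M × ℝ)` associated with a quasi-Vaisman structure on `M`. -/
abbrev vaismanPhi (J : Endo I M) (g : Metric I M) (θ : OneForm I M) :
    Endo (I.prod 𝓘(ℝ, ℝ)) (M × ℝ) :=
  prodPhi J θ (antiLee J θ) (metricDual g θ) (metricDual g (antiLee J θ))

/-- The `1`-form `h (ξ, ·)` on `M × ℝ`, where `ξ` is the lift of the anti-Lee field. -/
abbrev vaismanEta (J : Endo I M) (g : Metric I M) (θ : OneForm I M) :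
    OneForm (I.prod 𝓘(ℝ, ℝ)) (M × ℝ) := fun p =>
  g.prod.inner p (liftField (metricDual g (antiLee J θ)) p)

theorem vaismanEta_apply (p : M × ℝ) (v : TangentSpace (I.prod 𝓘(ℝ, ℝ)) p) :
    vaismanEta J g θ p v = antiLee J θ p.1 (prM p v) := by
  rw [g.prod_inner, liftField, prM_inclM, dt_inclM, inner_metricDual, zero_mul, add_zero]

namespace IsQuasiVaisman

variable (hM : IsQuasiVaisman J g θ)
include hM

/-- `φ (w + c ∂/∂t) = J w - θ(w) V + (η(w) - c) U + θ(w) ∂/∂t`, since `J U = V` and `J V = -U`. -/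
theorem vaismanPhi_apply (p : M × ℝ) (v : TangentSpace (I.prod 𝓘(ℝ, ℝ)) p) :
    vaismanPhi J g θ p v =
      inclM p (J p.1 (prM p v)) + (-θ p.1 (prM p v)) • liftField (metricDual g (antiLee J θ)) p
        + (antiLee J θ p.1 (prM p v) - dt p v) • liftField (metricDual g θ) p
        + θ p.1 (prM p v) • ddt p := by
  simp only [vaismanPhi, prodPhi, liftForm, liftField, add_apply, sub_apply,
    ContinuousLinearMap.comp_apply, ContinuousLinearMap.smulRight_apply, map_sub, map_smul,
    ContinuousLinearMap.id_apply, hM.apply_metricDual, hM.apply_metricDual_antiLee, map_neg]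
  module

theorem prM_vaismanPhi (p : M × ℝ) (v : TangentSpace (I.prod 𝓘(ℝ, ℝ)) p) :
    prM p (vaismanPhi J g θ p v) =
      J p.1 (prM p v) - θ p.1 (prM p v) • metricDual g (antiLee J θ) p.1
        + (antiLee J θ p.1 (prM p v) - dt p v) • metricDual g θ p.1 := by
  rw [hM.vaismanPhi_apply]
  simp only [liftField, map_add, map_smul, prM_inclM, prM_ddt]
  module

theorem dt_vaismanPhi (p : M × ℝ) (v : TangentSpace (I.prod 𝓘(ℝ, ℝ)) p) :
    dt p (vaismanPhi J g θ p v) = θ p.1 (prM p v) := by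
  rw [hM.vaismanPhi_apply]
  simp [liftField]

theorem isSmoothEndo_vaismanPhi : IsSmoothEndo (vaismanPhi J g θ) := by
  refine isSmoothEndo_of_app _ fun p X hX => ?_
  have hpr := contMDiffAt_prM hX
  have hθ : ContMDiffAt (I.prod 𝓘(ℝ, ℝ)) 𝓘(ℝ, ℝ) ∞ (fun q => θ q.1 (prM q (X q))) p :=
    (hM.smooth _).comp p hpr
  have hη : ContMDiffAt (I.prod 𝓘(ℝ, ℝ)) 𝓘(ℝ, ℝ) ∞ (fun q => antiLee J θ q.1 (prM q (X q))) p :=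
    (hM.isSmoothOneForm_antiLee _).comp p hpr
  have hJ := smoothFieldAt_inclM (w := fun q => J q.1 (prM q (X q)))
    ((hM.hermitian.smooth _).comp p hpr)
  have h1 := hθ.neg.smul_section (isSmoothField_liftField hM.isSmoothField_antiLee p)
  have h2 := (hη.sub (contMDiffAt_dt hX)).smul_section
    (isSmoothField_liftField hM.isSmoothField_lee p)
  have h3 := hθ.smul_section (isSmoothField_ddt p)
  have h4 := ((hJ.add_section h1).add_section h2).add_section h3
  refine h4.congr_of_eventuallyEq (.of_forall fun q => ?_)
  simp only [Endo.app, hM.vaismanPhi_apply]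
  rfl

theorem isAlmostContactMetric_vaisman :
    IsAlmostContactMetric (vaismanPhi J g θ) (liftField (metricDual g (antiLee J θ)))
      (vaismanEta J g θ) g.prod where
  smooth_φ := hM.isSmoothEndo_vaismanPhi
  smooth_ξ := isSmoothField_liftField hM.isSmoothField_antiLee
  smooth_η := isSmoothOneForm_of_app _ fun p X hX => by
    simp only [vaismanEta_apply]
    exact (hM.isSmoothOneForm_antiLee _).comp p (contMDiffAt_prM hX)
  sq p v := by
    rw [vaismanEta_apply]
    refine ext_prM_dt ?_ ?_
    · simp only [hM.prM_vaismanPhi, hM.dt_vaismanPhi, map_add, map_sub, map_smul, lee_apply,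
        hM.antiLee_apply, hM.hermitian.sq, hM.apply_metricDual, hM.apply_metricDual_antiLee,
        hM.lee_metricDual, hM.lee_metricDual_antiLee, hM.antiLee_metricDual,
        hM.antiLee_metricDual_antiLee, liftField, prM_inclM, map_neg, smul_eq_mul]
      module
    · simp only [hM.prM_vaismanPhi, hM.dt_vaismanPhi, map_add, map_sub, map_smul, lee_apply,
        hM.lee_metricDual, hM.lee_metricDual_antiLee, liftField, dt_inclM, map_neg, smul_eq_mul]
      ring
  reeb p := by
    rw [vaismanEta_apply, liftField, prM_inclM, hM.antiLee_metricDual_antiLee]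
  compat p v w := by
    have hUl : ∀ w, g.inner p.1 (metricDual g θ p.1) w = θ p.1 w := inner_metricDual g θ p.1
    have hVl : ∀ w, g.inner p.1 (metricDual g (antiLee J θ) p.1) w = antiLee J θ p.1 w :=
      inner_metricDual g _ p.1
    have hUr : ∀ w, g.inner p.1 w (metricDual g θ p.1) = θ p.1 w := fun w => by
      rw [g.symm, hUl]
    have hVr : ∀ w, g.inner p.1 w (metricDual g (antiLee J θ) p.1) = antiLee J θ p.1 w :=
      fun w => by rw [g.symm, hVl]
    rw [vaismanEta_apply, vaismanEta_apply]
    simp only [g.prod_inner, hM.prM_vaismanPhi, hM.dt_vaismanPhi, map_add,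
      map_sub, map_smul, add_apply, sub_apply, smul_apply, smul_eq_mul, hUl, hVl, hUr, hVr,
      lee_apply, hM.antiLee_apply, hM.hermitian.orthogonal, hM.lee_metricDual,
      hM.lee_metricDual_antiLee, hM.antiLee_metricDual, hM.antiLee_metricDual_antiLee]
    ring

end IsQuasiVaisman
end ProductStructure

/-! ### Normality and closedness on the product -/

section QuasiSasakian

variable {E : Type*} [NormedAddCommGroup E] [NormedSpace ℝ E]
  {H : Type*} [TopologicalSpace H] {I : ModelWithCorners ℝ E H}
  {M : Type*} [TopologicalSpace M] [ChartedSpace H M]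

/-- The vector field `W + c ∂/∂t` on `M × ℝ`. -/
def liftAdd (W : VField I M) (c : ℝ) : VField (I.prod 𝓘(ℝ, ℝ)) (M × ℝ) :=
  fun p => liftField W p + c • ddt p

@[simp] theorem prM_liftAdd (W : VField I M) (c : ℝ) (p : M × ℝ) :
    prM p (liftAdd W c p) = W p.1 := by
  simp [liftAdd, liftField]

@[simp] theorem dt_liftAdd (W : VField I M) (c : ℝ) (p : M × ℝ) : dt p (liftAdd W c p) = c := by
  simp [liftAdd, liftField]

variable [IsManifold I ∞ M]

theorem isSmoothField_liftAdd {W : VField I M} (hW : IsSmoothField W) (c : ℝ) :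
    IsSmoothField (liftAdd W c) := fun p =>
  (isSmoothField_liftField hW p).add_section
    ((contMDiffAt_const (c := c)).smul_section (isSmoothField_ddt p))

theorem mlieBracket_liftAdd [I.Boundaryless] [CompleteSpace E] {W W' : VField I M}
    (hW : IsSmoothField W) (hW' : IsSmoothField W') (c c' : ℝ) (p : M × ℝ) :
    mlieBracket (I.prod 𝓘(ℝ, ℝ)) (liftAdd W c) (liftAdd W' c') p =
      inclM p (mlieBracket I W W' p.1) :=
  mlieBracket_prod_eq (isSmoothField_liftAdd hW c) (isSmoothField_liftAdd hW' c')
    (dt_liftAdd W c) (dt_liftAdd W' c') hW hW' (prM_liftAdd W c) (prM_liftAdd W' c') p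

variable [FiniteDimensional ℝ E] {J : Endo I M} {g : Metric I M} {θ : OneForm I M}

/-- The field `J W - a V + s U` on `M`: the `M`-component of `φ (W + c ∂/∂t)` when `θ W = a` and
`s = η W - c`. -/
def phiBase (J : Endo I M) (g : Metric I M) (θ : OneForm I M) (W : VField I M) (a s : ℝ) :
    VField I M :=
  J.app W + ((-a) • metricDual g (antiLee J θ) + s • metricDual g θ)

namespace IsQuasiVaisman

variable (hM : IsQuasiVaisman J g θ)
include hM

theorem isAdapted_phiBase {W : VField I M} {a b : ℝ} (hW : IsAdapted J θ W a b) (s : ℝ) :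
    IsAdapted J θ (phiBase J g θ W a s) (s - b) 0 where
  smooth x := (hM.hermitian.smooth.isSmoothField hW.smooth x).add_section
    (((contMDiffAt_const (c := -a)).smul_section (hM.isSmoothField_antiLee x)).add_section
      ((contMDiffAt_const (c := s)).smul_section (hM.isSmoothField_lee x)))
  lee x := by
    have h := (hM.isAdapted_app hW).lee x
    simp only [phiBase, Pi.add_apply, Pi.smul_apply, map_add, map_smul, h,
      hM.lee_metricDual_antiLee, hM.lee_metricDual, smul_eq_mul]
    ring
  antiLee x := by
    have h := (hM.isAdapted_app hW).antiLee x
    simp only [phiBase, Pi.add_apply, Pi.smul_apply, map_add, map_smul, h,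
      hM.antiLee_metricDual_antiLee, hM.antiLee_metricDual, smul_eq_mul]
    ring

theorem app_vaismanPhi_liftAdd {W : VField I M} {a b : ℝ} (hW : IsAdapted J θ W a b) (c : ℝ) :
    (vaismanPhi J g θ).app (liftAdd W c) = liftAdd (phiBase J g θ W a (b - c)) a := by
  funext p
  refine ext_prM_dt ?_ ?_
  · rw [prM_liftAdd, Endo.app, hM.prM_vaismanPhi, prM_liftAdd, dt_liftAdd, hW.lee, hW.antiLee]
    simp only [phiBase, Pi.add_apply, Pi.smul_apply, Endo.app]
    module
  · rw [dt_liftAdd, Endo.app, hM.dt_vaismanPhi, prM_liftAdd, hW.lee]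

theorem exists_isAdapted_liftAdd [T2Space M] {p : M × ℝ}
    (v : TangentSpace (I.prod 𝓘(ℝ, ℝ)) p) :
    ∃ W a b c, IsAdapted J θ W a b ∧ liftAdd W c p = v := by
  obtain ⟨W, hW, hWx⟩ := hM.exists_isAdapted (prM p v)
  refine ⟨W, _, _, dt p v, hW, ?_⟩
  rw [liftAdd, liftField, hWx, inclM_prM_add_dt]

theorem mlieBracket_phiBase_left {W : VField I M} (hW : IsSmoothField W) (Y : VField I M)
    (a s : ℝ) (x : M) :
    mlieBracket I (phiBase J g θ W a s) Y x =
      mlieBracket I (J.app W) Y x - a • mlieBracket I (metricDual g (antiLee J θ)) Y x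
        + s • mlieBracket I (metricDual g θ) Y x := by
  have hJ := (hM.hermitian.smooth.isSmoothField hW).diffFieldAt x
  have hU := hM.isSmoothField_lee.diffFieldAt x
  have hV := hM.isSmoothField_antiLee.diffFieldAt x
  have hU' : SmoothFieldAt (s • metricDual g θ) x :=
    (contMDiffAt_const (c := s)).smul_section (hM.isSmoothField_lee x)
  have hV' : SmoothFieldAt ((-a) • metricDual g (antiLee J θ)) x :=
    (contMDiffAt_const (c := -a)).smul_section (hM.isSmoothField_antiLee x)
  have : CompleteSpace E := FiniteDimensional.complete ℝ E
  rw [phiBase, mlieBracket_add_left hJ (SmoothFieldAt.diffFieldAt (hV'.add_section hU')),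
    mlieBracket_add_left hV'.diffFieldAt hU'.diffFieldAt,
    mlieBracket_const_smul_left hV, mlieBracket_const_smul_left hU]
  module

theorem mlieBracket_phiBase_right {W : VField I M} (hW : IsSmoothField W) (Y : VField I M)
    (a s : ℝ) (x : M) :
    mlieBracket I Y (phiBase J g θ W a s) x =
      mlieBracket I Y (J.app W) x - a • mlieBracket I Y (metricDual g (antiLee J θ)) x
        + s • mlieBracket I Y (metricDual g θ) x := by
  rw [mlieBracket_swap_apply, hM.mlieBracket_phiBase_left hW,
    mlieBracket_swap_apply (V := Y) (W := J.app W),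
    mlieBracket_swap_apply (V := Y) (W := metricDual g (antiLee J θ)),
    mlieBracket_swap_apply (V := Y) (W := metricDual g θ)]
  module

theorem vaismanPhi_inclM {p : M × ℝ} {w : TangentSpace I p.1} (hθ : θ p.1 w = 0)
    (hη : antiLee J θ p.1 w = 0) : vaismanPhi J g θ p (inclM p w) = inclM p (J p.1 w) := by
  rw [hM.vaismanPhi_apply]
  simp [hθ, hη]

/-- `Φ = Ω + θ ∧ η + dt ∧ θ`. -/
theorem fundForm_vaisman (p : M × ℝ) (v w : TangentSpace (I.prod 𝓘(ℝ, ℝ)) p) :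
    fundForm g.prod (vaismanPhi J g θ) p v w =
      fundForm g J p.1 (prM p v) (prM p w) +
        (θ p.1 (prM p v) * antiLee J θ p.1 (prM p w)
          - antiLee J θ p.1 (prM p v) * θ p.1 (prM p w)
          + (dt p v * θ p.1 (prM p w) - θ p.1 (prM p v) * dt p w)) := by
  simp only [fundForm]
  rw [g.prod_inner, hM.prM_vaismanPhi, hM.dt_vaismanPhi]
  simp only [map_add, map_sub, map_smul, smul_eq_mul]
  rw [g.symm _ _ (metricDual g θ p.1), g.symm _ _ (metricDual g (antiLee J θ) p.1),
    inner_metricDual, inner_metricDual]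
  ring

theorem fundForm_swap (x : M) (v w : TangentSpace I x) :
    g.inner x v (J x w) = -g.inner x w (J x v) := by
  rw [g.symm x w, hM.inner_apply_left, neg_neg]

variable [I.Boundaryless] [T2Space M]

/-- On adapted fields `X = W + c ∂/∂t` and `Y = W' + c' ∂/∂t` the expression `N_φ + dη ⊗ ξ` equals
`N_J (W, W')`, because `U` and `V` are holomorphic. -/
theorem normal_vaisman {X Y : VField (I.prod 𝓘(ℝ, ℝ)) (M × ℝ)} (hX : IsSmoothField X)
    (hY : IsSmoothField Y) (p : M × ℝ) :
    nijenhuis (vaismanPhi J g θ) X Y p + dOne (vaismanEta J g θ) X Y p •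
      liftField (metricDual g (antiLee J θ)) p = 0 := by
  have : CompleteSpace E := FiniteDimensional.complete ℝ E
  have hac := hM.isAlmostContactMetric_vaisman
  obtain ⟨W, a, b, c, hW, hWp⟩ := hM.exists_isAdapted_liftAdd (X p)
  obtain ⟨W', a', b', c', hW', hWp'⟩ := hM.exists_isAdapted_liftAdd (Y p)
  have hs := (isSmoothField_liftAdd hW.smooth c).diffFieldAt p
  have hs' := (isSmoothField_liftAdd hW'.smooth c').diffFieldAt p
  rw [nijenhuis_congr hac.smooth_φ (hX.diffFieldAt p) hs (hY.diffFieldAt p) hs' hWp.symm hWp'.symm,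
    dOne_congr hac.smooth_η (hX.diffFieldAt p) hs (hY.diffFieldAt p) hs' hWp.symm hWp'.symm]
  have hP := hM.isAdapted_phiBase hW (b - c)
  have hP' := hM.isAdapted_phiBase hW' (b' - c')
  have hd : dOne (vaismanEta J g θ) (liftAdd W c) (liftAdd W' c') p =
      -antiLee J θ p.1 (mlieBracket I W W' p.1) := by
    simp only [dOne]
    rw [mlieBracket_liftAdd hW.smooth hW'.smooth]
    simp only [vaismanEta_apply, prM_liftAdd, prM_inclM, hW.antiLee, hW'.antiLee, lieFun_const]
    ring
  -- the lift of `S` is `[φ X, Y] + [X, φ Y]`; it has no `U`- and no `V`-component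
  set S := mlieBracket I (phiBase J g θ W a (b - c)) W' p.1
    + mlieBracket I W (phiBase J g θ W' a' (b' - c')) p.1 with hS
  have hSθ : θ p.1 S = 0 := by
    rw [hS, map_add, hM.lee_mlieBracket hP hW', hM.lee_mlieBracket hW hP', add_zero]
  have hSη : antiLee J θ p.1 S = 0 := by
    have h1 := hM.antiLee_mlieBracket_app_add hW hW' p.1
    rw [hS, hM.mlieBracket_phiBase_left hW.smooth _,
      hM.mlieBracket_phiBase_right hW'.smooth _,
      mlieBracket_swap_apply (V := W) (W := metricDual g (antiLee J θ)),
      mlieBracket_swap_apply (V := W) (W := metricDual g θ)]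
    simp only [map_add, map_sub, map_smul, map_neg, hM.antiLee_mlieBracket_lee hW,
      hM.antiLee_mlieBracket_lee hW', hM.antiLee_mlieBracket_antiLee hW,
      hM.antiLee_mlieBracket_antiLee hW'] at h1 ⊢
    simpa using h1
  -- the brackets with `U` and `V` in `[φ X, φ Y]` are those in `J S`, by holomorphy
  have hJJ : mlieBracket I (phiBase J g θ W a (b - c)) (phiBase J g θ W' a' (b' - c')) p.1
      = mlieBracket I (J.app W) (J.app W') p.1 + (J p.1 S
        - J p.1 (mlieBracket I (J.app W) W' p.1 + mlieBracket I W (J.app W') p.1)) := by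
    have hVU : mlieBracket I (metricDual g (antiLee J θ)) (metricDual g θ) p.1 = 0 := by
      rw [mlieBracket_swap_apply, hM.mlieBracket_lee_antiLee, neg_zero]
    rw [hS, hM.mlieBracket_phiBase_left hW.smooth _,
      hM.mlieBracket_phiBase_right hW'.smooth _,
      hM.mlieBracket_phiBase_right hW'.smooth _,
      hM.mlieBracket_phiBase_right hW'.smooth _,
      hM.mlieBracket_phiBase_left hW.smooth _,
      hM.mlieBracket_phiBase_right hW'.smooth _,
      mlieBracket_swap_apply (V := W) (W := metricDual g (antiLee J θ)),
      mlieBracket_swap_apply (V := W) (W := metricDual g θ),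
      mlieBracket_swap_apply (V := J.app W) (W := metricDual g (antiLee J θ)),
      mlieBracket_swap_apply (V := J.app W) (W := metricDual g θ), hVU,
      hM.mlieBracket_lee_antiLee, mlieBracket_self, mlieBracket_self,
      hM.mlieBracket_lee_app hW.smooth, hM.mlieBracket_lee_app hW'.smooth,
      hM.mlieBracket_antiLee_app hW.smooth, hM.mlieBracket_antiLee_app hW'.smooth]
    simp only [map_add, map_sub, map_smul, map_neg, Pi.zero_apply]
    module
  have hN := hM.hermitian.integrable W W' hW.smooth hW'.smooth p.1
  simp only [nijenhuis, hM.hermitian.sq] at hN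
  simp only [hd, nijenhuis, hM.app_vaismanPhi_liftAdd hW, hM.app_vaismanPhi_liftAdd hW',
    mlieBracket_liftAdd hW.smooth hW'.smooth, mlieBracket_liftAdd hP.smooth hW'.smooth,
    mlieBracket_liftAdd hW.smooth hP'.smooth, mlieBracket_liftAdd hP.smooth hP'.smooth]
  rw [← map_add (inclM p), ← hS, hM.vaismanPhi_inclM hSθ hSη, hac.sq, vaismanEta_apply, prM_inclM,
    hJJ]
  have h2 := congrArg (inclM p) hN
  simp only [map_add, map_sub, map_neg, map_zero] at h2 ⊢
  rw [← h2]
  module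

/-- `dΦ = dΩ - dη ∧ θ = 0`. -/
theorem closed_vaisman {X Y Z : VField (I.prod 𝓘(ℝ, ℝ)) (M × ℝ)} (hX : IsSmoothField X)
    (hY : IsSmoothField Y) (hZ : IsSmoothField Z) (p : M × ℝ) :
    dTwo (fundForm g.prod (vaismanPhi J g θ)) X Y Z p = 0 := by
  have : CompleteSpace E := FiniteDimensional.complete ℝ E
  have hσ : IsTwoForm (fundForm g.prod (vaismanPhi J g θ)) :=
    isTwoForm_fundForm _ hM.isSmoothEndo_vaismanPhi fun p v w => by
      change fundForm g.prod (vaismanPhi J g θ) p v w = -fundForm g.prod (vaismanPhi J g θ) p w v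
      rw [hM.fundForm_vaisman, hM.fundForm_vaisman, fundForm, fundForm, hM.fundForm_swap]
      ring
  obtain ⟨W, a, b, c, hW, hWp⟩ := hM.exists_isAdapted_liftAdd (X p)
  obtain ⟨W', a', b', c', hW', hWp'⟩ := hM.exists_isAdapted_liftAdd (Y p)
  obtain ⟨W'', a'', b'', c'', hW'', hWp''⟩ := hM.exists_isAdapted_liftAdd (Z p)
  rw [hσ.dTwo_congr (hX.diffFieldAt p) ((isSmoothField_liftAdd hW.smooth c).diffFieldAt p)
    (hY.diffFieldAt p) ((isSmoothField_liftAdd hW'.smooth c').diffFieldAt p)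
    (hZ.diffFieldAt p) ((isSmoothField_liftAdd hW''.smooth c'').diffFieldAt p)
    hWp.symm hWp'.symm hWp''.symm]
  have hΩ {W W' : VField I M} (hW : IsSmoothField W) (hW' : IsSmoothField W') :
      MDifferentiableAt I 𝓘(ℝ, ℝ) (fun y => fundForm g J y (W y) (W' y)) p.1 :=
    g.mdifferentiableAt_inner (hW.diffFieldAt _)
      (hM.hermitian.smooth.diffFieldAt (hW'.diffFieldAt _))
  have hd := hM.d_fundForm W W' W'' hW.smooth hW'.smooth hW''.smooth p.1
  simp only [dOneWedge, dOne_antiLee_of_isAdapted hW hW', dOne_antiLee_of_isAdapted hW' hW'',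
    dOne_antiLee_of_isAdapted hW'' hW, hW.lee, hW'.lee, hW''.lee, dTwo] at hd
  rw [mlieBracket_swap_apply (V := W'') (W := W)] at hd
  simp only [dTwo, mlieBracket_liftAdd hW.smooth hW'.smooth,
    mlieBracket_liftAdd hW.smooth hW''.smooth,
    mlieBracket_liftAdd hW'.smooth hW''.smooth, hM.fundForm_vaisman, prM_liftAdd, dt_liftAdd,
    prM_inclM, dt_inclM, hW.lee, hW'.lee, hW''.lee, hW.antiLee, hW'.antiLee, hW''.antiLee,
    hM.lee_mlieBracket hW hW', hM.lee_mlieBracket hW hW'', hM.lee_mlieBracket hW' hW'']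
  rw [lieFun_comp_fst_add_const (prM_liftAdd W c p) (hΩ hW'.smooth hW''.smooth),
    lieFun_comp_fst_add_const (prM_liftAdd W' c' p) (hΩ hW.smooth hW''.smooth),
    lieFun_comp_fst_add_const (prM_liftAdd W'' c'' p) (hΩ hW.smooth hW'.smooth)]
  simp only [map_neg] at hd
  linear_combination hd

theorem isQuasiSasakian_vaisman :
    IsQuasiSasakian (vaismanPhi J g θ) (liftField (metricDual g (antiLee J θ)))
      (vaismanEta J g θ) g.prod where
  toIsAlmostContactMetric := hM.isAlmostContactMetric_vaisman
  normal _ _ hX hY p := hM.normal_vaisman hX hY p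
  closed _ _ _ hX hY hZ p := hM.closed_vaisman hX hY hZ p

end IsQuasiVaisman
end QuasiSasakian

/-! ### Quotients by smooth deck maps -/

section QuotientManifold

variable {E : Type*} [NormedAddCommGroup E] [NormedSpace ℝ E]
  {H : Type*} [TopologicalSpace H] {I : ModelWithCorners ℝ E H}
  {N : Type*} [TopologicalSpace N] [ChartedSpace H N]
  {Q : Type*} [TopologicalSpace Q] {q : N → Q}

variable (I) in
/-- Any two points in a fibre of `q` are related by a smooth self-map over `q`. -/
def HasSmoothDeck (q : N → Q) : Prop :=
  ∀ x y, q x = q y → ∃ τ : N → N, ContMDiff I I ∞ τ ∧ (∀ z, q (τ z) = q z) ∧ τ x = y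

variable (hq : IsLocalHomeomorph q) (hdeck : HasSmoothDeck I q)
include hdeck

/-- Near each point, a local inverse of `q` after `q` is a deck map. -/
theorem HasSmoothDeck.contMDiffAt_localInverseAt_comp {y z : N}
    (hz : q z ∈ (hq.localInverseAt y).source) :
    ContMDiffAt I I ∞ (fun w => hq.localInverseAt y (q w)) z := by
  obtain ⟨τ, hτ, hqτ, hτz⟩ := hdeck z (hq.localInverseAt y (q z))
    (hq.apply_localInverseAt_of_mem hz).symm
  refine hτ.contMDiffAt.congr_of_eventuallyEq ?_
  have hev : ∀ᶠ w in 𝓝 z, τ w ∈ (hq.localInverseAt y).target :=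
    hτ.continuous.continuousAt.eventually ((hq.localInverseAt y).open_target.mem_nhds
      (by rw [hτz]; exact (hq.localInverseAt y).map_source hz))
  filter_upwards [hev] with w hw
  have h1 := (hq.localInverseAt y).right_inv hw
  rwa [hq.localInverseAt_symm, hqτ] at h1

theorem HasSmoothDeck.isLocalDiffeomorph {s : Q → N} (hs : Function.RightInverse s q) :
    let _ := hq.chartedSpaceOfRightInverse (H := H) hs
    IsLocalDiffeomorph I I ∞ q := by
  let _ := hq.chartedSpaceOfRightInverse (H := H) hs
  have hext (m : Q) : (extChartAt I m : Q → E) =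
      fun w => extChartAt I (s m) (hq.localInverseAt (s m) w) := rfl
  have hexts (m : Q) : ((extChartAt I m).symm : E → Q) =
      fun w => q ((extChartAt I (s m)).symm w) := by
    funext w
    rw [← congrFun (hq.localInverseAt_symm (s m))]
    rfl
  have hself (m : Q) : hq.localInverseAt (s m) m = s m := by
    have := hq.localInverseAt_apply_self (x := s m)
    rwa [hs m] at this
  have hmem (m : Q) : m ∈ (hq.localInverseAt (s m)).source := by
    have := hq.apply_self_mem_localInverseAt_source (x := s m)
    rwa [hs m] at this
  have hsm : ContMDiff I I ∞ q := by
    intro x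
    rw [contMDiffAt_iff_target, hext]
    refine ⟨hq.continuous.continuousAt, ?_⟩
    have h1 := hdeck.contMDiffAt_localInverseAt_comp hq (hmem (q x))
    have h2 : ContMDiffAt I 𝓘(ℝ, E) ∞ (extChartAt I (s (q x)))
        (hq.localInverseAt (s (q x)) (q x)) := by
      rw [hself]
      exact contMDiffAt_extChartAt
    exact ContMDiffAt.comp (f := fun w => hq.localInverseAt (s (q x)) (q w)) x h2 h1
  have hinv (x : N) : ContMDiffOn I I ∞ (hq.localInverseAt x) (hq.localInverseAt x).source := by
    intro m hm
    refine ContMDiffAt.contMDiffWithinAt ?_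
    rw [contMDiffAt_iff_source, hexts, hext]
    beta_reduce
    rw [hself]
    have h0 : (extChartAt I (s m)).symm (extChartAt I (s m) (s m)) = s m :=
      extChartAt_to_inv (I := I) (s m)
    have h1 := hdeck.contMDiffAt_localInverseAt_comp hq (y := x) (z := s m) (by rwa [hs m])
    rw [← h0] at h1
    exact h1.comp_contMDiffWithinAt _ (contMDiffWithinAt_extChartAt_symm_range_self (s m))
  change IsLocalDiffeomorph I I ∞ q
  intro x
  refine ⟨{ toPartialEquiv := (hq.localInverseAt x).symm.toPartialEquiv
            open_source := (hq.localInverseAt x).open_target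
            open_target := (hq.localInverseAt x).open_source
            contMDiffOn_toFun := ?_
            contMDiffOn_invFun := ?_ }, ?_, ?_⟩
  · change ContMDiffOn I I ∞ (hq.localInverseAt x).symm _
    rw [hq.localInverseAt_symm]
    exact hsm.contMDiffOn
  · exact hinv x
  · exact hq.self_mem_localInverseAt_target
  · intro w _
    exact (congrFun (hq.localInverseAt_symm x) w).symm

variable [IsManifold I ∞ N]

/-- Transition maps are, in charts of `N`, local inverses of `q` after `q`. -/
theorem HasSmoothDeck.isManifold {s : Q → N} (hs : Function.RightInverse s q) :
    let _ := hq.chartedSpaceOfRightInverse (H := H) hs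
    IsManifold I ∞ Q := by
  let _ := hq.chartedSpaceOfRightInverse (H := H) hs
  refine isManifold_of_contDiffOn I ∞ Q ?_
  rintro _ _ ⟨a, rfl⟩ ⟨b, rfl⟩
  rw [← contMDiffOn_iff_contDiffOn]
  intro z hz
  have hz2 : I.symm z ∈ (chartAt H (s a)).target ∧
      q ((chartAt H (s a)).symm (I.symm z)) ∈ (hq.localInverseAt (s b)).source ∧
      hq.localInverseAt (s b) (q ((chartAt H (s a)).symm (I.symm z))) ∈
        (chartAt H (s b)).source := by
    have := hz.1
    simp only [Set.mem_preimage, OpenPartialHomeomorph.trans_source,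
      OpenPartialHomeomorph.symm_source, OpenPartialHomeomorph.trans_target, Set.mem_inter_iff,
      OpenPartialHomeomorph.coe_trans_symm, Function.comp_apply,
      hq.localInverseAt_symm] at this
    exact ⟨this.1.1, this.2⟩
  have h1 : ContMDiffWithinAt 𝓘(ℝ, E) I ∞ I.symm (Set.range I) z := I.contMDiffOn_symm z hz.2
  have h2 : ContMDiffAt I I ∞ (chartAt H (s a)).symm (I.symm z) :=
    contMDiffOn_chart_symm.contMDiffAt ((chartAt H (s a)).open_target.mem_nhds hz2.1)
  have h3 := hdeck.contMDiffAt_localInverseAt_comp hq hz2.2.1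
  have h4 := (contMDiffOn_chart (I := I) (n := ∞) (x := s b)).contMDiffAt
    ((chartAt H (s b)).open_source.mem_nhds hz2.2.2)
  have h5 := ContMDiffAt.comp (f := fun w => hq.localInverseAt (s b) (q w)) _
    ((I.contMDiff _).comp _ h4) h3
  refine (((h5.comp _ h2).comp_contMDiffWithinAt z h1).mono Set.inter_subset_right).congr_of_mem
    (fun w _ => ?_) hz
  simp [Function.comp_def]

end QuotientManifold

/-! ### The mapping torus as a manifold -/

section MappingTorusTopology

variable {M : Type*}

/-- The action of `k : ℤ` on `M × ℝ`. -/
def deck (f : Equiv.Perm M) (a : ℝ) (k : ℤ) (p : M × ℝ) : M × ℝ := ((f ^ k) p.1, p.2 + a * k)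

theorem MappingTorus.proj_eq_iff {f : Equiv.Perm M} {a : ℝ} {p r : M × ℝ} :
    MappingTorus.proj f a p = MappingTorus.proj f a r ↔ ∃ k : ℤ, r = deck f a k p :=
  Quotient.eq (r := mappingTorusSetoid f a)

theorem MappingTorus.proj_deck (f : Equiv.Perm M) (a : ℝ) (k : ℤ) (p : M × ℝ) :
    MappingTorus.proj f a (deck f a k p) = MappingTorus.proj f a p :=
  (MappingTorus.proj_eq_iff.2 ⟨k, rfl⟩).symm

theorem MappingTorus.surjective_proj (f : Equiv.Perm M) (a : ℝ) :
    Function.Surjective (MappingTorus.proj f a) := Quotient.mk_surjective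

/-- Two points of an orbit differ in height by a multiple of `a`. -/
theorem MappingTorus.injOn_proj (f : Equiv.Perm M) {a : ℝ} (ha : 0 < a) (t : ℝ) :
    Set.InjOn (MappingTorus.proj f a) {p | |p.2 - t| < a / 2} := by
  intro p hp r hr h
  obtain ⟨k, rfl⟩ := MappingTorus.proj_eq_iff.1 h
  have h1 : |a * (k : ℝ)| < a := by
    have h2 : a * (k : ℝ) = ((deck f a k p).2 - t) - (p.2 - t) := by simp [deck]
    rw [h2]
    calc _ ≤ _ := abs_sub _ _
      _ < a / 2 + a / 2 := add_lt_add hr hp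
      _ = a := by ring
  have h3 : |(k : ℝ)| < 1 := by
    rw [abs_mul, abs_of_pos ha] at h1
    nlinarith
  have h4 : k = 0 := Int.abs_lt_one_iff.1 (by exact_mod_cast h3)
  simp [h4, deck]

variable [TopologicalSpace M]

theorem continuous_zpow_homeomorph (f : M ≃ₜ M) (k : ℤ) :
    Continuous ((f.toEquiv : Equiv.Perm M) ^ k : Equiv.Perm M) := by
  induction k with
  | zero => simpa using continuous_id
  | succ n ih =>
    rw [zpow_add_one]
    exact ih.comp f.continuous
  | pred n ih =>
    rw [zpow_sub_one]
    exact ih.comp f.symm.continuous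

theorem continuous_deck (f : M ≃ₜ M) (a : ℝ) (k : ℤ) : Continuous (deck f.toEquiv a k) :=
  ((continuous_zpow_homeomorph f k).comp continuous_fst).prodMk (by fun_prop)

theorem MappingTorus.continuous_proj (f : Equiv.Perm M) (a : ℝ) :
    Continuous (MappingTorus.proj f a) := continuous_quot_mk

theorem MappingTorus.isOpenQuotientMap_proj (f : M ≃ₜ M) (a : ℝ) :
    IsOpenQuotientMap (MappingTorus.proj f.toEquiv a) := by
  refine ⟨MappingTorus.surjective_proj _ _, MappingTorus.continuous_proj _ _, fun s hs => ?_⟩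
  have h : MappingTorus.proj f.toEquiv a ⁻¹' (MappingTorus.proj f.toEquiv a '' s) =
      ⋃ k : ℤ, deck f.toEquiv a k ⁻¹' s := by
    ext p
    simp only [Set.mem_preimage, Set.mem_image, Set.mem_iUnion]
    constructor
    · rintro ⟨r, hr, hrp⟩
      obtain ⟨k, rfl⟩ := MappingTorus.proj_eq_iff.1 hrp.symm
      exact ⟨k, hr⟩
    · rintro ⟨k, hk⟩
      exact ⟨_, hk, MappingTorus.proj_deck _ _ _ _⟩
  change IsOpen (MappingTorus.proj f.toEquiv a ⁻¹' (MappingTorus.proj f.toEquiv a '' s))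
  rw [h]
  exact isOpen_iUnion fun k => hs.preimage (continuous_deck f a k)

theorem MappingTorus.isLocalHomeomorph_proj (f : M ≃ₜ M) {a : ℝ} (ha : 0 < a) :
    IsLocalHomeomorph (MappingTorus.proj f.toEquiv a) := by
  rw [isLocalHomeomorph_iff_isOpenEmbedding_restrict]
  intro p
  have ho : IsOpen {r : M × ℝ | |r.2 - p.2| < a / 2} :=
    isOpen_lt (by fun_prop) continuous_const
  refine ⟨_, ho.mem_nhds (by simpa using ha), ?_⟩
  refine .of_continuous_injective_isOpenMap
    ((MappingTorus.continuous_proj _ _).comp continuous_subtype_val)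
    (Set.injOn_iff_injective.1 (MappingTorus.injOn_proj _ ha _))
    ((MappingTorus.isOpenQuotientMap_proj f a).isOpenMap.domRestrict ho)

/-- The orbit relation is closed: it is a locally finite union of graphs. -/
theorem MappingTorus.t2Space [T2Space M] (f : M ≃ₜ M) {a : ℝ} (ha : 0 < a) :
    T2Space (MappingTorus f.toEquiv a) := by
  rw [t2Space_iff_of_isOpenQuotientMap (MappingTorus.isOpenQuotientMap_proj f a)]
  have h : {q : (M × ℝ) × (M × ℝ) | MappingTorus.proj f.toEquiv a q.1 =
      MappingTorus.proj f.toEquiv a q.2} = ⋃ k : ℤ, {q | q.2 = deck f.toEquiv a k q.1} := by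
    ext q
    simp only [Set.mem_ofPred_eq, Set.mem_iUnion, MappingTorus.proj_eq_iff]
  rw [h]
  refine LocallyFinite.isClosed_iUnion (fun q₀ => ?_) fun k =>
    isClosed_eq continuous_snd ((continuous_deck f a k).comp continuous_fst)
  let c : (M × ℝ) × (M × ℝ) → ℝ := fun q => (q.2.2 - q.1.2) / a
  have hc : Continuous c := by fun_prop
  refine ⟨{q | |c q - c q₀| < 1},
    (isOpen_lt (by fun_prop) continuous_const).mem_nhds (by simp), ?_⟩
  refine (Set.finite_Icc ⌊c q₀ - 1⌋ ⌈c q₀ + 1⌉).subset ?_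
  rintro k ⟨q, hq, hqc⟩
  have h1 : c q = k := by
    simp only [Set.mem_ofPred_eq] at hq
    simp only [c, hq, deck]
    field_simp
    ring
  rw [Set.mem_ofPred_eq, h1, abs_lt] at hqc
  constructor
  · exact_mod_cast (Int.floor_le _).trans (by linarith : c q₀ - 1 ≤ k)
  · exact_mod_cast (by linarith : (k : ℝ) ≤ c q₀ + 1).trans (Int.le_ceil _)

theorem MappingTorus.secondCountableTopology [SecondCountableTopology M] (f : M ≃ₜ M) (a : ℝ) :
    SecondCountableTopology (MappingTorus f.toEquiv a) :=
  (MappingTorus.isOpenQuotientMap_proj f a).isQuotientMap.secondCountableTopology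
    (MappingTorus.isOpenQuotientMap_proj f a).isOpenMap

end MappingTorusTopology

section MappingTorusDeck

variable {E : Type*} [NormedAddCommGroup E] [NormedSpace ℝ E]
  {H : Type*} [TopologicalSpace H] {I : ModelWithCorners ℝ E H}
  {M : Type*} [TopologicalSpace M] [ChartedSpace H M]

theorem contMDiff_zpow_diffeomorph (f : M ≃ₘ^∞⟮I, I⟯ M) (k : ℤ) :
    ContMDiff I I ∞ ((f.toEquiv : Equiv.Perm M) ^ k : Equiv.Perm M) := by
  induction k with
  | zero => simpa using contMDiff_id
  | succ n ih =>
    rw [zpow_add_one]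
    exact ih.comp f.contMDiff
  | pred n ih =>
    rw [zpow_sub_one]
    exact ih.comp f.symm.contMDiff

theorem contMDiff_deck (f : M ≃ₘ^∞⟮I, I⟯ M) (a : ℝ) (k : ℤ) :
    ContMDiff (I.prod 𝓘(ℝ, ℝ)) (I.prod 𝓘(ℝ, ℝ)) ∞ (deck f.toEquiv a k) :=
  ((contMDiff_zpow_diffeomorph f k).comp contMDiff_fst).prodMk
    ((contDiff_id.add contDiff_const).contMDiff.comp contMDiff_snd)

theorem MappingTorus.hasSmoothDeck_proj (f : M ≃ₘ^∞⟮I, I⟯ M) (a : ℝ) :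
    HasSmoothDeck (I.prod 𝓘(ℝ, ℝ)) (MappingTorus.proj f.toEquiv a) := fun _ _ h =>
  let ⟨k, hk⟩ := MappingTorus.proj_eq_iff.1 h
  ⟨_, contMDiff_deck f a k, MappingTorus.proj_deck _ _ _, hk.symm⟩

end MappingTorusDeck

/-! ### Naturality under local diffeomorphisms -/

section LocalDiffeo

variable {E : Type*} [NormedAddCommGroup E] [NormedSpace ℝ E]
  {H : Type*} [TopologicalSpace H] {I : ModelWithCorners ℝ E H}
  {N : Type*} [TopologicalSpace N] [ChartedSpace H N]
  {Q : Type*} [TopologicalSpace Q] [ChartedSpace H Q] {q : N → Q}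

/-- The fields `X'` on `N` and `X` on `Q` are `q`-related. -/
def Related (q : N → Q) (X' : VField I N) (X : VField I Q) : Prop :=
  ∀ p, mfderiv I I q p (X' p) = X (q p)

theorem Related.lieFun_comp {X' : VField I N} {X : VField I Q} (h : Related q X' X) {p : N}
    (hq : MDifferentiableAt I I q p) {f : Q → ℝ} (hf : MDifferentiableAt I 𝓘(ℝ, ℝ) f (q p)) :
    lieFun X' (fun y => f (q y)) p = lieFun X f (q p) := by
  simp only [lieFun]
  rw [mvfderiv_comp_apply' (I' := I) p hf hq, h]

variable (hq : IsLocalDiffeomorph I I ∞ q)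
include hq

theorem _root_.IsLocalDiffeomorph.isInvertible_mfderiv (p : N) : (mfderiv I I q p).IsInvertible :=
  ⟨(hq p).mfderivToContinuousLinearEquiv (by simp), rfl⟩

theorem _root_.IsLocalDiffeomorph.related_mpullback (X : VField I Q) :
    Related q (mpullback I I q X) X := fun p =>
  (hq.isInvertible_mfderiv p).self_apply_inverse _

theorem Related.eq_mpullback {X' : VField I N} {X : VField I Q} (h : Related q X' X) :
    X' = mpullback I I q X :=
  funext fun p => (hq.isInvertible_mfderiv p).injective
    ((h p).trans (hq.related_mpullback X p).symm)

theorem _root_.IsLocalDiffeomorph.contMDiffAt_of_comp {f : Q → ℝ} {p : N}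
    (hf : ContMDiffAt I 𝓘(ℝ, ℝ) ∞ (fun y => f (q y)) p) : ContMDiffAt I 𝓘(ℝ, ℝ) ∞ f (q p) := by
  have h0 : (hq p).localInverse (q p) = p :=
    (hq p).localInverse_left_inv (hq p).localInverse_mem_target
  rw [← h0] at hf
  refine (hf.comp (q p) (hq p).localInverse_contMDiffAt).congr_of_eventuallyEq ?_
  filter_upwards [(hq p).localInverse_eventuallyEq_right] with y hy
  exact (congrArg f hy).symm

variable [IsManifold I ∞ N] [IsManifold I ∞ Q]

theorem Related.smoothFieldAt {X' : VField I N} {X : VField I Q} (h : Related q X' X) {p : N}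
    (hX : SmoothFieldAt X' p) : SmoothFieldAt X (q p) := by
  have h0 : (hq p).localInverse (q p) = p :=
    (hq p).localInverse_left_inv (hq p).localInverse_mem_target
  have h1 : ContMDiffAt I I.tangent ∞ (fun y => (⟨q y, X (q y)⟩ : TangentBundle I Q)) p := by
    refine (((hq.contMDiff).contMDiff_tangentMap (m := ∞) (by simp) ⟨p, X' p⟩).comp p
      hX).congr_of_eventuallyEq (.of_forall fun y => ?_)
    simp only [Function.comp_apply, tangentMap, h y]
  rw [← h0] at h1
  refine (h1.comp (q p) (hq p).localInverse_contMDiffAt).congr_of_eventuallyEq ?_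
  filter_upwards [(hq p).localInverse_eventuallyEq_right] with y hy
  have hy' : q ((hq p).localInverse y) = y := hy
  simp only [Function.comp_apply]
  rw [hy']

variable [CompleteSpace E]

theorem Related.smoothFieldAt_symm {X' : VField I N} {X : VField I Q} (h : Related q X' X) {p : N}
    (hX : SmoothFieldAt X (q p)) : SmoothFieldAt X' p := by
  rw [Related.eq_mpullback hq h]
  exact ContMDiffAt.mpullback_vectorField_preimage hX (hq.contMDiff p)
    (hq.isInvertible_mfderiv p) (by simp)

theorem Related.mlieBracket {X' Y' : VField I N} {X Y : VField I Q} (hX : Related q X' X)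
    (hY : Related q Y' Y) {p : N} (hXd : DiffFieldAt X (q p)) (hYd : DiffFieldAt Y (q p)) :
    mfderiv I I q p (VectorField.mlieBracket I X' Y' p) = VectorField.mlieBracket I X Y (q p) := by
  have hmin : minSmoothness ℝ 2 ≤ ((⊤ : ℕ∞) : WithTop ℕ∞) := by
    rw [minSmoothness_of_isRCLikeNormedField]
    exact WithTop.coe_le_coe.2 le_top
  have : IsManifold I (minSmoothness ℝ 2) N := .of_le hmin
  have : IsManifold I (minSmoothness ℝ 2) Q := .of_le hmin
  rw [Related.eq_mpullback hq hX, Related.eq_mpullback hq hY,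
    ← mpullback_mlieBracket hXd hYd (hq.contMDiff p) hmin]
  exact hq.related_mpullback _ p

end LocalDiffeo

section Transport

variable {E : Type*} [NormedAddCommGroup E] [NormedSpace ℝ E]
  {H : Type*} [TopologicalSpace H] {I : ModelWithCorners ℝ E H}
  {N : Type*} [TopologicalSpace N] [ChartedSpace H N] [IsManifold I ∞ N]
  {Q : Type*} [TopologicalSpace Q] [ChartedSpace H Q] [IsManifold I ∞ Q] {q : N → Q}
  {φ : Endo I N} {ξ : VField I N} {η : OneForm I N} {h : Metric I N}
  {φ' : Endo I Q} {ξ' : VField I Q} {η' : OneForm I Q} {h' : Metric I Q}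

theorem IsInducedBy.related_app (hi : IsInducedBy q φ ξ η h φ' ξ' η' h') {X : VField I N}
    {X' : VField I Q} (hX : Related q X X') : Related q (φ.app X) (φ'.app X') := fun p => by
  rw [Endo.app, Endo.app, ← hi.endo, hX]

variable [FiniteDimensional ℝ E]

/-- An induced structure is almost contact metric. -/
theorem IsInducedBy.isAlmostContactMetric (hi : IsInducedBy q φ ξ η h φ' ξ' η' h')
    (hq : IsLocalDiffeomorph I I ∞ q) (hsurj : Function.Surjective q)
    (hs : IsAlmostContactMetric φ ξ η h) : IsAlmostContactMetric φ' ξ' η' h' := by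
  have : CompleteSpace E := FiniteDimensional.complete ℝ E
  have hdq (p : N) : Function.Surjective (mfderiv I I q p) :=
    (hq.isInvertible_mfderiv p).surjective
  refine ⟨isSmoothEndo_of_app _ fun m X hX => ?_, fun m => ?_,
    isSmoothOneForm_of_app _ fun m X hX => ?_, fun m v => ?_, fun m => ?_, fun m v w => ?_⟩
  all_goals obtain ⟨p, rfl⟩ := hsurj m
  · have hX' := hq.related_mpullback X
    exact (hi.related_app hX').smoothFieldAt hq
      (hs.smooth_φ.smoothFieldAt (hX'.smoothFieldAt_symm hq hX))
  · exact Related.smoothFieldAt hq (fun p => (hi.field p).symm) (hs.smooth_ξ p)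
  · have hX' := hq.related_mpullback X
    refine hq.contMDiffAt_of_comp
      ((hs.smooth_η.contMDiffAt (hX'.smoothFieldAt_symm hq hX)).congr_of_eventuallyEq
        (.of_forall fun y => ?_))
    beta_reduce
    rw [← hX' y, hi.form]
  · obtain ⟨v, rfl⟩ := hdq p v
    rw [hi.endo, hi.endo, hs.sq, hi.form, hi.field, map_add, map_neg, map_smul]
  · rw [hi.field, hi.form, hs.reeb]
  · obtain ⟨v, rfl⟩ := hdq p v
    obtain ⟨w, rfl⟩ := hdq p w
    rw [hi.endo, hi.endo, hi.metric, hi.metric, hi.form, hi.form, hs.compat]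

/-- Every term of the two structure equations is natural under local diffeomorphisms. -/
theorem IsInducedBy.isQuasiSasakian (hi : IsInducedBy q φ ξ η h φ' ξ' η' h')
    (hq : IsLocalDiffeomorph I I ∞ q) (hsurj : Function.Surjective q)
    (hs : IsQuasiSasakian φ ξ η h) : IsQuasiSasakian φ' ξ' η' h' := by
  have : CompleteSpace E := FiniteDimensional.complete ℝ E
  have hac := hi.isAlmostContactMetric hq hsurj hs.toIsAlmostContactMetric
  have hpb {X : VField I Q} (hX : IsSmoothField X) : IsSmoothField (mpullback I I q X) := fun p =>
    (hq.related_mpullback X).smoothFieldAt_symm hq (hX _)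
  refine ⟨hac, fun X Y hX hY m => ?_, fun X Y Z hX hY hZ m => ?_⟩
  all_goals obtain ⟨p, rfl⟩ := hsurj m
  · have rX := hq.related_mpullback X
    have rY := hq.related_mpullback Y
    have dX := hX.diffFieldAt (q p)
    have dY := hY.diffFieldAt (q p)
    have dφX := hac.smooth_φ.diffFieldAt dX
    have dφY := hac.smooth_φ.diffFieldAt dY
    have hN : mfderiv I I q p (nijenhuis φ (mpullback I I q X) (mpullback I I q Y) p) =
        nijenhuis φ' X Y (q p) := by
      simp only [nijenhuis, map_add, map_sub, ← hi.endo]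
      rw [rX.mlieBracket hq rY dX dY, (hi.related_app rX).mlieBracket hq rY dφX dY,
        rX.mlieBracket hq (hi.related_app rY) dX dφY,
        (hi.related_app rX).mlieBracket hq (hi.related_app rY) dφX dφY]
    have hη {Z W : VField I Q} (hZ : IsSmoothField Z) :
        lieFun (mpullback I I q W) (fun y => η y (mpullback I I q Z y)) p =
          lieFun W (fun y => η' y (Z y)) (q p) := by
      rw [← (hq.related_mpullback W).lieFun_comp
        ((hq p).mdifferentiableAt (by simp)) (hac.smooth_η.mdifferentiableAt (hZ.diffFieldAt _))]
      congr 1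
      funext y
      rw [← hi.form, hq.related_mpullback Z]
    have hd : dOne η (mpullback I I q X) (mpullback I I q Y) p = dOne η' X Y (q p) := by
      simp only [dOne]
      rw [hη hY, hη hX, ← hi.form, rX.mlieBracket hq rY dX dY]
    have h1 := congrArg (mfderiv I I q p) (hs.normal _ _ (hpb hX) (hpb hY) p)
    rw [map_add, map_smul, map_zero, hN, hd, ← hi.field] at h1
    exact h1
  · have rX := hq.related_mpullback X
    have rY := hq.related_mpullback Y
    have rZ := hq.related_mpullback Z
    have dX := hX.diffFieldAt (q p)
    have dY := hY.diffFieldAt (q p)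
    have dZ := hZ.diffFieldAt (q p)
    have hΦ (y : N) (v w : TangentSpace I y) :
        fundForm h φ y v w = fundForm h' φ' (q y) (mfderiv I I q y v) (mfderiv I I q y w) := by
      rw [fundForm, fundForm, hi.endo, hi.metric]
    have hL {W A B : VField I Q} (hA : IsSmoothField A) (hB : IsSmoothField B) :
        lieFun (mpullback I I q W)
          (fun y => fundForm h φ y (mpullback I I q A y) (mpullback I I q B y)) p =
          lieFun W (fun y => fundForm h' φ' y (A y) (B y)) (q p) := by
      have hAB : MDifferentiableAt I 𝓘(ℝ, ℝ) (fun y => fundForm h' φ' y (A y) (B y)) (q p) :=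
        h'.mdifferentiableAt_inner (hA.diffFieldAt _) (hac.smooth_φ.diffFieldAt (hB.diffFieldAt _))
      rw [← (hq.related_mpullback W).lieFun_comp
        ((hq p).mdifferentiableAt (by simp)) hAB]
      congr 1
      funext y
      rw [hΦ, hq.related_mpullback A, hq.related_mpullback B]
    have h1 := hs.closed _ _ _ (hpb hX) (hpb hY) (hpb hZ) p
    simp only [dTwo] at h1 ⊢
    rw [hL hY hZ, hL hX hZ, hL hX hY, hΦ, hΦ, hΦ, rX.mlieBracket hq rY dX dY,
      rX.mlieBracket hq rZ dX dZ, rY.mlieBracket hq rZ dY dZ, rX p, rY p, rZ p] at h1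
    exact h1

end Transport

/-! ### Descent of invariant structures -/

section Descent

variable {E : Type*} [NormedAddCommGroup E] [NormedSpace ℝ E] [FiniteDimensional ℝ E]
  {H : Type*} [TopologicalSpace H] {I : ModelWithCorners ℝ E H}
  {N : Type*} [TopologicalSpace N] [ChartedSpace H N] [IsManifold I ∞ N]
  {Q : Type*} [TopologicalSpace Q] [ChartedSpace H Q] [IsManifold I ∞ Q] {q : N → Q}
  {φ : Endo I N} {ξ : VField I N} {η : OneForm I N} {h : Metric I N}

/-- A structure on `N` that is invariant under maps relating any two points of a fibre of the local
diffeomorphism `q : N → Q` descends to `Q`: the value at `m` is obtained by transport along the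
differential of `q` at any point over `m`. -/
theorem exists_isInducedBy (hq : IsLocalDiffeomorph I I ∞ q) (hsurj : Function.Surjective q)
    (hinv : ∀ x y, q x = q y → ∃ τ : N → N, ContMDiff I I ∞ τ ∧ (∀ z, q (τ z) = q z) ∧ τ x = y ∧
      IsInducedBy τ φ ξ η h φ ξ η h) (hs : IsQuasiSasakian φ ξ η h) :
    ∃ φ' ξ' η' h', IsQuasiSasakian φ' ξ' η' h' ∧
      IsInducedBy (I := I) (N := Q) q φ ξ η h φ' ξ' η' h' := by
  choose s hsq using hsurj
  let e : ∀ p, E ≃L[ℝ] E := fun p => (hq p).mfderivToContinuousLinearEquiv (by simp)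
  have he (p : N) (v : E) : e p v = mfderiv I I q p v := rfl
  let A : ∀ p : N, E →L[ℝ] E := fun p => φ p
  let X : N → E := ξ
  let α : ∀ p : N, E →L[ℝ] ℝ := fun p => η p
  let B : ∀ p : N, E →L[ℝ] E →L[ℝ] ℝ := fun p => h.inner p
  -- the differentials of `q` at two points of a fibre differ by a map that preserves the structure
  have key (x y : N) (hxy : q x = q y) : ∃ T : E →L[ℝ] E, (∀ v, e y (T v) = e x v) ∧
      (∀ v, A y (T v) = T (A x v)) ∧ X y = T (X x) ∧ (∀ v, α y (T v) = α x v) ∧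
      ∀ v w, B y (T v) (T w) = B x v w := by
    obtain ⟨τ, hτ, hqτ, rfl, hi⟩ := hinv x y hxy
    refine ⟨mfderiv I I τ x, fun v => ?_, hi.endo x, hi.field x, hi.form x, hi.metric x⟩
    have h1 := mfderiv_comp_apply x ((hq (τ x)).mdifferentiableAt (by simp))
      (hτ.mdifferentiable (by simp) x) v
    rw [he, he]
    refine h1.symm.trans ?_
    rw [show q ∘ τ = q from funext hqτ]
  let φ' : Endo I Q := fun m =>
    ((e (s m) : E →L[ℝ] E) ∘L A (s m) ∘L ((e (s m)).symm : E →L[ℝ] E) : E →L[ℝ] E)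
  let ξ' : VField I Q := fun m => (e (s m) (X (s m)) : E)
  let η' : OneForm I Q := fun m => (α (s m) ∘L ((e (s m)).symm : E →L[ℝ] E) : E →L[ℝ] ℝ)
  let B' : ∀ m : Q, E →L[ℝ] E →L[ℝ] ℝ := fun m =>
    (B (s m)).bilinearComp ((e (s m)).symm : E →L[ℝ] E) ((e (s m)).symm : E →L[ℝ] E)
  have hφ' (p : N) (v : E) : φ' (q p) (e p v) = e p (A p v) := by
    obtain ⟨T, h1, h2, -⟩ := key p (s (q p)) (hsq _).symm
    change e (s (q p)) (A (s (q p)) ((e (s (q p))).symm (e p v))) = _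
    rw [← h1, ContinuousLinearEquiv.symm_apply_apply, h2, h1]
  have hξ' (p : N) : ξ' (q p) = e p (X p) := by
    obtain ⟨T, h1, -, h2, -⟩ := key p (s (q p)) (hsq _).symm
    change e (s (q p)) (X (s (q p))) = _
    rw [h2, h1]
  have hη' (p : N) (v : E) : η' (q p) (e p v) = α p v := by
    obtain ⟨T, h1, -, -, h2, -⟩ := key p (s (q p)) (hsq _).symm
    change α (s (q p)) ((e (s (q p))).symm (e p v)) = _
    rw [← h1, ContinuousLinearEquiv.symm_apply_apply, h2]
  have hB' (p : N) (v w : E) : B' (q p) (e p v) (e p w) = B p v w := by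
    obtain ⟨T, h1, -, -, -, h2⟩ := key p (s (q p)) (hsq _).symm
    change B (s (q p)) ((e (s (q p))).symm (e p v)) ((e (s (q p))).symm (e p w)) = _
    rw [← h1, ← h1, ContinuousLinearEquiv.symm_apply_apply, ContinuousLinearEquiv.symm_apply_apply,
      h2]
  have hsurj : Function.Surjective q := fun m => ⟨s m, hsq m⟩
  let h' : Metric I Q := Metric.ofBilin B'
    (fun m v w => h.symm (s m) _ _)
    (fun m v hv => h.pos (s m) _ fun h0 => hv ((e (s m)).symm.map_eq_zero_iff.1 h0))
    (fun m Y Z hY hZ => by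
      have : CompleteSpace E := FiniteDimensional.complete ℝ E
      obtain ⟨p, rfl⟩ := hsurj m
      have rY := hq.related_mpullback Y
      have rZ := hq.related_mpullback Z
      refine hq.contMDiffAt_of_comp
        ((h.contMDiffAt_inner (rY.smoothFieldAt_symm hq hY)
          (rZ.smoothFieldAt_symm hq hZ)).congr_of_eventuallyEq (.of_forall fun y => ?_))
      beta_reduce
      rw [← rY y, ← rZ y]
      exact hB' y _ _)
  have hi : IsInducedBy q φ ξ η h φ' ξ' η' h' := ⟨hφ', hξ', hη', hB'⟩
  exact ⟨φ', ξ', η', h', hi.isQuasiSasakian hq hsurj hs, hi⟩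

end Descent

section Automorphisms

variable {E : Type*} [NormedAddCommGroup E] [NormedSpace ℝ E]
  {H : Type*} [TopologicalSpace H] {I : ModelWithCorners ℝ E H}
  {M : Type*} [TopologicalSpace M] [ChartedSpace H M] [IsManifold I ∞ M]
  {J : Endo I M} {g : Metric I M} {θ : OneForm I M}

/-- Smooth self-maps preserving `J`, `g` and `θ`. -/
structure IsAutomorphism (J : Endo I M) (g : Metric I M) (θ : OneForm I M) (F : M → M) :
    Prop where
  smooth : ContMDiff I I ∞ F
  metric : ∀ (x : M) (v w : TangentSpace I x),
    g.inner (F x) (mfderiv I I F x v) (mfderiv I I F x w) = g.inner x v w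
  complex : ∀ (x : M) (v : TangentSpace I x), mfderiv I I F x (J x v) = J (F x) (mfderiv I I F x v)
  form : ∀ (x : M) (v : TangentSpace I x), θ (F x) (mfderiv I I F x v) = θ x v

theorem isAutomorphism_id : IsAutomorphism J g θ id := by
  refine ⟨contMDiff_id, fun x v w => ?_, fun x v => ?_, fun x v => ?_⟩
  all_goals
    rw [mfderiv_id]
    rfl

namespace IsAutomorphism

theorem injective_mfderiv {F : M → M} (hF : IsAutomorphism J g θ F) (x : M) :
    Function.Injective (mfderiv I I F x) := by
  refine (injective_iff_map_eq_zero _).2 fun v hv => ?_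
  by_contra hne
  have h1 := hF.metric x v v
  rw [hv, map_zero] at h1
  exact (g.pos x v hne).ne h1

theorem comp {F G : M → M} (hF : IsAutomorphism J g θ F) (hG : IsAutomorphism J g θ G) :
    IsAutomorphism J g θ (F ∘ G) := by
  have h (x : M) (v : TangentSpace I x) :
      mfderiv I I (F ∘ G) x v = mfderiv I I F (G x) (mfderiv I I G x v) :=
    mfderiv_comp_apply x (hF.smooth.mdifferentiable (by simp) _)
      (hG.smooth.mdifferentiable (by simp) _) v
  refine ⟨hF.smooth.comp hG.smooth, fun x v w => ?_, fun x v => ?_, fun x v => ?_⟩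
  · rw [h, h]
    exact (hF.metric _ _ _).trans (hG.metric _ _ _)
  · rw [h, h, hG.complex]
    exact hF.complex _ _
  · rw [h]
    exact (hF.form _ _).trans (hG.form _ _)

theorem of_leftInverse {F G : M → M} (hF : IsAutomorphism J g θ F) (hG : ContMDiff I I ∞ G)
    (hFG : ∀ x, F (G x) = x) : IsAutomorphism J g θ G := by
  have h (x : M) (v : TangentSpace I x) : mfderiv I I F (G x) (mfderiv I I G x v) = v := by
    have h1 := mfderiv_comp_apply x (hF.smooth.mdifferentiable (by simp) (G x))
      (hG.mdifferentiable (by simp) x) v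
    refine h1.symm.trans ?_
    rw [show F ∘ G = id from funext hFG, mfderiv_id]
    rfl
  have hg (x y : M) (hxy : y = x) (v w : E) :
      (g.inner y : E →L[ℝ] E →L[ℝ] ℝ) v w = (g.inner x : E →L[ℝ] E →L[ℝ] ℝ) v w := by rw [hxy]
  have hJ (x y : M) (hxy : y = x) (v : E) : (J y : E →L[ℝ] E) v = (J x : E →L[ℝ] E) v := by
    rw [hxy]
  have hθ (x y : M) (hxy : y = x) (v : E) : (θ y : E →L[ℝ] ℝ) v = (θ x : E →L[ℝ] ℝ) v := by
    rw [hxy]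
  refine ⟨hG, fun x v w => ?_, fun x v => ?_, fun x v => ?_⟩
  · have h1 := hF.metric (G x) (mfderiv I I G x v) (mfderiv I I G x w)
    rw [← h1, h, h]
    exact hg _ _ (hFG x) v w
  · apply hF.injective_mfderiv (G x)
    rw [h, hF.complex, h]
    exact (hJ _ _ (hFG x) v).symm
  · have h1 := hF.form (G x) (mfderiv I I G x v)
    rw [← h1, h]
    exact hθ _ _ (hFG x) v

theorem zpow {f : M ≃ₘ^∞⟮I, I⟯ M} (hf : Preserves f J g θ) (k : ℤ) :
    IsAutomorphism J g θ ((f.toEquiv : Equiv.Perm M) ^ k : Equiv.Perm M) := by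
  have h1 : IsAutomorphism J g θ f := ⟨f.contMDiff, hf.metric, hf.complex, hf.form⟩
  have h2 : IsAutomorphism J g θ f.symm := h1.of_leftInverse f.symm.contMDiff f.apply_symm_apply
  induction k with
  | zero =>
    rw [zpow_zero]
    exact isAutomorphism_id
  | succ n ih =>
    rw [zpow_add_one]
    exact ih.comp h1
  | pred n ih =>
    rw [zpow_sub_one]
    exact ih.comp h2

variable {F : M → M} (hF : IsAutomorphism J g θ F)
include hF

theorem antiLee_apply (x : M) (v : TangentSpace I x) :
    antiLee J θ (F x) (mfderiv I I F x v) = antiLee J θ x v := by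
  have h1 := hF.form x (J x v)
  rw [hF.complex, lee_apply, lee_apply] at h1
  exact neg_injective h1

variable [FiniteDimensional ℝ E]

theorem surjective_mfderiv (x : M) : Function.Surjective (mfderiv I I F x) := by
  let L : E →L[ℝ] E := mfderiv I I F x
  have h1 : Function.Injective L.toLinearMap := hF.injective_mfderiv x
  have h2 : Function.Surjective L.toLinearMap := LinearMap.injective_iff_surjective.1 h1
  exact h2

/-- The differential of an automorphism is surjective, so `α` determines its dual at `F x`. -/
theorem metricDual_apply {α : OneForm I M} (hα : ∀ x v, α (F x) (mfderiv I I F x v) = α x v)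
    (x : M) : metricDual g α (F x) = mfderiv I I F x (metricDual g α x) := by
  refine g.ext_inner fun w => ?_
  obtain ⟨w, rfl⟩ := hF.surjective_mfderiv x w
  rw [hF.metric, inner_metricDual, inner_metricDual, hα]

/-- The structure on `M × ℝ` is invariant under `(x, t) ↦ (F x, t + c)`. -/
theorem isInducedBy_prod (hM : IsQuasiVaisman J g θ) (c : ℝ) :
    IsInducedBy (fun p : M × ℝ => (F p.1, p.2 + c))
      (vaismanPhi J g θ) (liftField (metricDual g (antiLee J θ))) (vaismanEta J g θ) g.prod
      (vaismanPhi J g θ) (liftField (metricDual g (antiLee J θ))) (vaismanEta J g θ) g.prod := by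
  set τ : M × ℝ → M × ℝ := fun p => (F p.1, p.2 + c) 
  have hτ : ContMDiff (I.prod 𝓘(ℝ, ℝ)) (I.prod 𝓘(ℝ, ℝ)) ∞ τ :=
    (hF.smooth.comp contMDiff_fst).prodMk
      ((contDiff_id.add contDiff_const).contMDiff.comp contMDiff_snd)
  have hpr (p : M × ℝ) (v : TangentSpace (I.prod 𝓘(ℝ, ℝ)) p) :
      prM (τ p) (mfderiv (I.prod 𝓘(ℝ, ℝ)) (I.prod 𝓘(ℝ, ℝ)) τ p v) =
        mfderiv I I F p.1 (prM p v) := by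
    have h1 := mfderiv_comp_apply p (mdifferentiableAt_fst (I := I) (I' := 𝓘(ℝ, ℝ)) (x := τ p))
      (hτ.mdifferentiable (by simp) p) v
    have h2 := mfderiv_comp_apply p (hF.smooth.mdifferentiable (by simp) p.1)
      (mdifferentiableAt_fst (I := I) (I' := 𝓘(ℝ, ℝ)) (x := p)) v
    exact h1.symm.trans h2
  have hdt (p : M × ℝ) (v : TangentSpace (I.prod 𝓘(ℝ, ℝ)) p) :
      dt (τ p) (mfderiv (I.prod 𝓘(ℝ, ℝ)) (I.prod 𝓘(ℝ, ℝ)) τ p v) = dt p v := by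
    have h1 := mvfderiv_comp_apply' (g := (Prod.snd : M × ℝ → ℝ)) (f := τ) p mdifferentiableAt_snd
      (hτ.mdifferentiable (by simp) p) v
    refine h1.symm.trans ?_
    change mvfderiv (I.prod 𝓘(ℝ, ℝ)) ((Prod.snd : M × ℝ → ℝ) + fun _ => c) p v = _
    rw [mvfderiv_add mdifferentiableAt_snd mdifferentiableAt_const, mvfderiv_const]
    simp [dt]
  have hU := hF.metricDual_apply hF.form
  have hV := hF.metricDual_apply hF.antiLee_apply
  refine ⟨fun p v => ?_, fun p => ?_, fun p v => ?_, fun p v w => ?_⟩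
  · refine ext_prM_dt ?_ ?_
    · rw [hM.prM_vaismanPhi, hpr, hpr, hM.prM_vaismanPhi, hdt]
      change J (F p.1) _ - θ (F p.1) _ • metricDual g (antiLee J θ) (F p.1)
        + (antiLee J θ (F p.1) _ - dt p v) • metricDual g θ (F p.1) = _
      simp only [map_add, map_sub, map_smul, hF.complex, hF.form, hF.antiLee_apply, hU, hV]
    · rw [hM.dt_vaismanPhi, hpr, hdt, hM.dt_vaismanPhi]
      exact hF.form _ _
  · refine ext_prM_dt ?_ ?_
    · rw [hpr, liftField, liftField, prM_inclM, prM_inclM]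
      exact hV _
    · rw [hdt, liftField, liftField, dt_inclM, dt_inclM]
  · rw [vaismanEta_apply, vaismanEta_apply, hpr]
    exact hF.antiLee_apply _ _
  · rw [g.prod_inner, g.prod_inner, hpr, hpr, hdt, hdt]
    exact congrArg (· + _) (hF.metric _ _ _)

end IsAutomorphism
end Automorphisms

end QV

end

theorem mainTheorem10 {E : Type*} [NormedAddCommGroup E] [NormedSpace ℝ E] [FiniteDimensional ℝ E]
    {M : Type*} [TopologicalSpace M] [ChartedSpace E M] [IsManifold 𝓘(ℝ, E) ∞ M]
    [T2Space M] [SecondCountableTopology M]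
    (J : QV.Endo 𝓘(ℝ, E) M) (g : QV.Metric 𝓘(ℝ, E) M) (θ : QV.OneForm 𝓘(ℝ, E) M)
    (hM : QV.IsQuasiVaisman J g θ)
    (U V : QV.VField 𝓘(ℝ, E) M) (hU : U = QV.metricDual g θ)
    (hV : V = QV.metricDual g (QV.antiLee J θ))
    (φ : QV.Endo (𝓘(ℝ, E).prod 𝓘(ℝ, ℝ)) (M × ℝ)) (hφ : φ = QV.prodPhi J θ (QV.antiLee J θ) U V)
    (ξ : QV.VField (𝓘(ℝ, E).prod 𝓘(ℝ, ℝ)) (M × ℝ)) (hξ : ξ = QV.liftField V) :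
    (∀ p : M × ℝ,
      φ p (QV.liftField U p) = QV.ddt p ∧ φ p (QV.ddt p) = -QV.liftField U p ∧
      φ p (QV.liftField V p) = 0 ∧
      ∀ v : TangentSpace 𝓘(ℝ, E) p.1,
        g.inner p.1 (U p.1) v = 0 → g.inner p.1 (V p.1) v = 0 →
          φ p (QV.inclM p v) = QV.inclM p (J p.1 v)) ∧
    ∃ (h : QV.Metric (𝓘(ℝ, E).prod 𝓘(ℝ, ℝ)) (M × ℝ))
      (η : QV.OneForm (𝓘(ℝ, E).prod 𝓘(ℝ, ℝ)) (M × ℝ)),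
      (∀ (p : M × ℝ) (v w : TangentSpace (𝓘(ℝ, E).prod 𝓘(ℝ, ℝ)) p),
        h.inner p v w = g.inner p.1 (QV.prM p v) (QV.prM p w) + QV.dt p v * QV.dt p w) ∧
      (∀ p, η p = h.inner p (ξ p)) ∧
      QV.IsQuasiSasakian φ ξ η h ∧
      ∀ f : M ≃ₘ^∞⟮𝓘(ℝ, E), 𝓘(ℝ, E)⟯ M, QV.Preserves f J g θ → ∀ a : ℝ, 0 < a →
        T2Space (QV.MappingTorus f.toEquiv a) ∧
        SecondCountableTopology (QV.MappingTorus f.toEquiv a) ∧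
        ∃ (_ : ChartedSpace (ModelProd E ℝ) (QV.MappingTorus f.toEquiv a))
          (_ : IsManifold (𝓘(ℝ, E).prod 𝓘(ℝ, ℝ)) ∞ (QV.MappingTorus f.toEquiv a)),
          IsLocalDiffeomorph (𝓘(ℝ, E).prod 𝓘(ℝ, ℝ)) (𝓘(ℝ, E).prod 𝓘(ℝ, ℝ)) ∞
            (QV.MappingTorus.proj f.toEquiv a) ∧
          ∃ (φ' : QV.Endo (𝓘(ℝ, E).prod 𝓘(ℝ, ℝ)) (QV.MappingTorus f.toEquiv a))
            (ξ' : QV.VField (𝓘(ℝ, E).prod 𝓘(ℝ, ℝ)) (QV.MappingTorus f.toEquiv a))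
            (η' : QV.OneForm (𝓘(ℝ, E).prod 𝓘(ℝ, ℝ)) (QV.MappingTorus f.toEquiv a))
            (h' : QV.Metric (𝓘(ℝ, E).prod 𝓘(ℝ, ℝ)) (QV.MappingTorus f.toEquiv a)),
            QV.IsQuasiSasakian φ' ξ' η' h' ∧
            QV.IsInducedBy (QV.MappingTorus.proj f.toEquiv a) φ ξ η h φ' ξ' η' h' := by

  subst hU hV hφ hξ
  refine ⟨fun p => ⟨?_, ?_, ?_, fun v hUv hVv => ?_⟩, g.prod, QV.vaismanEta J g θ,
    g.prod_inner, fun p => rfl, hM.isQuasiSasakian_vaisman, fun f hf a ha => ?_⟩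
  · refine QV.ext_prM_dt ?_ ?_
    · rw [hM.prM_vaismanPhi]
      simp [QV.liftField, hM.apply_metricDual, hM.lee_metricDual, hM.antiLee_metricDual]
    · rw [hM.dt_vaismanPhi]
      simp [QV.liftField, hM.lee_metricDual]
  · refine QV.ext_prM_dt ?_ ?_
    · rw [hM.prM_vaismanPhi]
      simp [QV.liftField]
    · rw [hM.dt_vaismanPhi]
      simp [QV.liftField]
  · refine QV.ext_prM_dt ?_ ?_
    · rw [hM.prM_vaismanPhi]
      simp [QV.liftField, hM.apply_metricDual_antiLee, hM.lee_metricDual_antiLee,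
        hM.antiLee_metricDual_antiLee]
    · rw [hM.dt_vaismanPhi]
      simp [QV.liftField, hM.lee_metricDual_antiLee]
  · rw [QV.inner_metricDual] at hUv hVv
    exact hM.vaismanPhi_inclM hUv hVv
  · have hloc := QV.MappingTorus.isLocalHomeomorph_proj f.toHomeomorph ha
    have hdeck := QV.MappingTorus.hasSmoothDeck_proj f a
    obtain ⟨s, hs⟩ := (QV.MappingTorus.surjective_proj f.toEquiv a).hasRightInverse
    let cs : ChartedSpace (ModelProd E ℝ) (QV.MappingTorus f.toEquiv a) :=
      hloc.chartedSpaceOfRightInverse hs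
    have hman : IsManifold (𝓘(ℝ, E).prod 𝓘(ℝ, ℝ)) ∞ (QV.MappingTorus f.toEquiv a) :=
      hdeck.isManifold hloc hs
    have hdiff : IsLocalDiffeomorph (𝓘(ℝ, E).prod 𝓘(ℝ, ℝ)) (𝓘(ℝ, E).prod 𝓘(ℝ, ℝ)) ∞
        (QV.MappingTorus.proj f.toEquiv a) :=
      hdeck.isLocalDiffeomorph hloc hs
    refine ⟨QV.MappingTorus.t2Space f.toHomeomorph ha,
      QV.MappingTorus.secondCountableTopology f.toHomeomorph a, cs, hman, hdiff, ?_⟩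
    refine QV.exists_isInducedBy hdiff (QV.MappingTorus.surjective_proj f.toEquiv a)
      (fun x y hxy => ?_) hM.isQuasiSasakian_vaisman
    obtain ⟨k, rfl⟩ := QV.MappingTorus.proj_eq_iff.1 hxy
    exact ⟨QV.deck f.toEquiv a k, QV.contMDiff_deck f a k, QV.MappingTorus.proj_deck _ _ _, rfl,
      (QV.IsAutomorphism.zpow hf k).isInducedBy_prod hM _⟩
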